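/- For a finite abelian group $G$ (written additively) with $|G| = 2n$ and a set $X \subseteq G$, let $r(X)$ be the number of $x \in X$ with $x = -x$; put $\alpha(G) = \log r(G)/\log n$, $\beta(G) = r(G)/n$, and for $\delta > 0$ let $$\lambda^{(\delta)}(G) = \begin{cases} 1/3 & \text{if } \alpha(G) \le 5/6,\\ \alpha(G) - 1/2 & \text{if } \alpha(G) > 5/6 \text{ and } \beta(G) < \delta,\\ 2/(4-\beta(G)) & \text{otherwise.}\end{cases}$$ A set $B\subseteq G$ is sum-free if there are no (not necessarily distinct) $x,y \in B$ with $x+y \in B$. For $A \subseteq G$ let $\mathrm{SF}(A)$ be the collection of maximum-size sum-free subsets of $A$; in particular, when $|G|=2n$, $\mathrm{SF}(G)$ consists of the odd cosets $\mathcal O$ (the complements of the subgroups of index $2$). For $\mathcal{O} \in \mathrm{SF}(G)$, the set $\mathcal{E} = G \setminus \mathcal{O}$ is called nice (with parameter $\delta$) if either $r(G) \le \delta n$ or $r(\mathcal{O}) = r(\mathcal{E})$. A $p$-random subset $A$ of $G$ contains each element of $G$ independently with probability $p$. **Proposition.** For every $\varepsilon > 0$ there is $\delta_0 = \delta_0(\varepsilon)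 > 0$ such that for every $0 < \delta < \delta_0$ and every function $\omega\colon \mathbb{N} \to \mathbb{R}$ with $\omega(n) \to \infty$ as $n \to \infty$ there is $n_0 = n_0(\varepsilon, \delta, \omega)$ such that the following holds for every $n \ge n_0$. Let $G$ be an abelian group of order $2n$, let $\mathcal{O} \in \mathrm{SF}(G)$ be such that $\mathcal{E} = G \setminus \mathcal{O}$ is nice with parameter $\delta$, and let $p \in (0,1)$ satisfy $$\omega(n)\,\frac{\log n}{n} \;\le\; p \;\le\; (1-\varepsilon) \sqrt{\lambda^{(\delta)}(G)\, \frac{\log n}{n}}.$$ If $A$ is a $p$-random subset of $G$, then $$\mathbb{P}\big( A \cap \mathcal{O} \in \mathrm{SF}(A) \big) \;\le\; \frac{1}{n^2}.$$ -/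

import Mathlib

open Filter Topology MeasureTheory ProbabilityTheory

namespace SumFreeThreshold

variable {G : Type*} [AddCommGroup G]

/-- `B` is sum-free: there are no `x, y, z ∈ B` (not necessarily distinct) with `x + y = z`. -/
def IsSumFree (B : Set G) : Prop :=
  ∀ x ∈ B, ∀ y ∈ B, x + y ∉ B

/-- `SF A` is the collection of maximum-size sum-free subsets of `A`
(used only in finite groups, where `Set.ncard` is the cardinality). -/
def SF (A : Set G) : Set (Set G) :=
  {B | B ⊆ A ∧ IsSumFree B ∧ ∀ C ⊆ A, IsSumFree C → C.ncard ≤ B.ncard}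

/-- `r X` is the number of elements `x ∈ X` with `x = -x`. -/
noncomputable def r (X : Set G) : ℕ :=
  {x ∈ X | x = -x}.ncard

variable (G) in
/-- Half of the order of `G`: this is `n` when `|G| = 2n`. -/
noncomputable def halfOrder : ℝ :=
  (Nat.card G : ℝ) / 2

variable (G) in
/-- `α(G) = log r(G) / log n`, where `|G| = 2n`. -/
noncomputable def alpha : ℝ :=
  Real.log (r (Set.univ : Set G)) / Real.log (halfOrder G)

variable (G) in
/-- `β(G) = r(G) / n`, where `|G| = 2n`. -/
noncomputable def beta : ℝ :=
  (r (Set.univ : Set G) : ℝ) / halfOrder G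

open Classical in
variable (G) in
/-- The threshold constant `λ^(δ)(G)`. -/
noncomputable def thresholdConst (δ : ℝ) : ℝ :=
  if alpha G ≤ 5 / 6 then 1 / 3
  else if beta G < δ then alpha G - 1 / 2
  else 2 / (4 - beta G)

/-- `E` is nice (with parameter `δ`): either `r(G) ≤ δ n`, where `|G| = 2n`, or
`r(O) = r(E)`, where `O = G \ E`. -/
def IsNice (δ : ℝ) (E : Set G) : Prop :=
  (r (Set.univ : Set G) : ℝ) ≤ δ * halfOrder G ∨ r Eᶜ = r E

end SumFreeThreshold

open SumFreeThreshold

/-! Write `B` for the random odd part `A ∩ O`. If an even nonzero `x ∈ A` is neither a sum nor a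
difference of two elements of `B`, then `B ∪ {x}` is sum-free by parity, so `B` is not of maximum
size. The set of such uncovered `x` depends only on `B`, while `A \ O` is independent of `B`. Hence
once `s` elements are uncovered, all of them are missed with probability at most `exp (-p s)`
(`setBernoulli_inter_mem_SF_le`). For `p` of order at least `n ^ (-1/2)` it suffices that `s = n ^
(1/2 + γ)`.

The uncovered elements are counted inside a convenient set `S` of even elements. When `O` is exposed
one element at a time and `A` is already present, a new element covers a given `x` for at most `c
|A| + 2` choices. So the count shrinks on average by a factor of about `1 - c k / n` at step `k`,
that is by `exp (-c p² n / 2)` over the `p n` steps. For the lower tail the potential `max (count,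
s) ^ (-t)` is followed: its mean grows in a controlled way, and Markov's inequality for a large
fixed `t` gives the bound `n ^ (-3)` (`bernoulliSum_lt_or_card_gt_le`).

The threshold constants are the solutions of `|S| exp (-c p² n / 2) ≈ n ^ (1/2)`. A general `x` is
joined to `y` through `x - y`, `y - x` and `x + y`, so `c = 3`, `|S| ≈ n`, and `λ = 1/3`. If `x =
-x` and `x` is not a double, two of these agree, so `c = 2`, `|S| ≈ n ^ α`, and `λ = α - 1/2`. If `β
≥ δ` and half of the involutions are odd, all three agree when `y` is an involution too. Exposing
the `β n / 2` odd involutions first (`c = 1`) and the rest afterwards (`c = 2`) gives exponent `p² n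
(4 - β) / 4`, hence `λ = 2 / (4 - β)`. -/

open SumFreeThreshold

/-! ### Expectations over `p`-random subsets of a finite set. -/

section BernoulliSums

variable {V : Type*}

/-- The expectation of `f A`, where `A` is a `p`-random subset of the finite set `U`. -/
def bernoulliSum (U : Finset V) (p : ℝ) (f : Finset V → ℝ) : ℝ :=
  ∑ A ∈ U.powerset, p ^ A.card * (1 - p) ^ (U.card - A.card) * f A

theorem bernoulliSum_empty (p : ℝ) (f : Finset V → ℝ) : bernoulliSum ∅ p f = f ∅ := by
  simp [bernoulliSum]

theorem bernoulliSum_add (U : Finset V) (p : ℝ) (f g : Finset V → ℝ) :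
    bernoulliSum U p (fun A => f A + g A) = bernoulliSum U p f + bernoulliSum U p g := by
  simp [bernoulliSum, mul_add, Finset.sum_add_distrib]

theorem bernoulliSum_mul_left (U : Finset V) (p : ℝ) (c : ℝ) (f : Finset V → ℝ) :
    bernoulliSum U p (fun A => c * f A) = c * bernoulliSum U p f := by
  simp only [bernoulliSum, Finset.mul_sum]
  exact Finset.sum_congr rfl fun A _ => by ring

theorem bernoulliSum_congr {U : Finset V} {p : ℝ} {f g : Finset V → ℝ}
    (h : ∀ A ⊆ U, f A = g A) : bernoulliSum U p f = bernoulliSum U p g :=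
  Finset.sum_congr rfl fun A hA => by rw [h A (Finset.mem_powerset.1 hA)]

theorem bernoulliSum_mono {U : Finset V} {p : ℝ} (hp0 : 0 ≤ p) (hp1 : p ≤ 1)
    {f g : Finset V → ℝ} (h : ∀ A ⊆ U, f A ≤ g A) :
    bernoulliSum U p f ≤ bernoulliSum U p g := by
  refine Finset.sum_le_sum fun A hA => ?_
  have : 0 ≤ 1 - p := by linarith
  exact mul_le_mul_of_nonneg_left (h A (Finset.mem_powerset.1 hA)) (by positivity)

theorem bernoulliSum_pow_card (U : Finset V) (p x : ℝ) :
    bernoulliSum U p (fun A => x ^ A.card) = (p * x + (1 - p)) ^ U.card := by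
  rw [← Finset.sum_pow_mul_eq_add_pow]
  refine Finset.sum_congr rfl fun A _ => ?_
  rw [mul_pow]
  ring

theorem bernoulliSum_const (U : Finset V) (p c : ℝ) :
    bernoulliSum U p (fun _ => c) = c := by
  have h := bernoulliSum_pow_card U p 1
  simp only [one_pow, mul_one, add_sub_cancel] at h
  have h2 := bernoulliSum_mul_left U p c (fun _ => 1)
  simpa [h] using h2

/-- Chernoff's bound for the size of a `p`-random subset. -/
theorem bernoulliSum_card_gt_le {U : Finset V} {p η : ℝ} (hp0 : 0 ≤ p) (hp1 : p ≤ 1)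
    (hη0 : 0 ≤ η) (hη1 : η ≤ 1) :
    bernoulliSum U p (fun A => if (1 + η) * p * U.card < A.card then 1 else 0) ≤
      Real.exp (-(η ^ 2 * p * U.card / 4)) := by
  set N : ℝ := (U.card : ℝ)
  set m : ℝ := (1 + η) * p * N
  -- Exponential Markov with parameter `η / 2`, which is not optimal but lets `exp` be replaced by
  -- its quadratic bound.
  have h1 : bernoulliSum U p (fun A => if m < A.card then 1 else 0) ≤
      bernoulliSum U p (fun A => Real.exp (-(η / 2) * m) * Real.exp (η / 2) ^ A.card) := by
    refine bernoulliSum_mono hp0 hp1 fun A _ => ?_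
    rw [← Real.exp_nat_mul, ← Real.exp_add]
    split_ifs with h
    · rw [Real.one_le_exp_iff]
      nlinarith
    · positivity
  refine h1.trans ?_
  rw [bernoulliSum_mul_left, bernoulliSum_pow_card]
  have h2 : Real.exp (η / 2) ≤ 1 + η / 2 + (η / 2) ^ 2 := by
    have := Real.abs_exp_sub_one_sub_id_le (x := η / 2) (by rw [abs_of_nonneg] <;> linarith)
    have := (abs_le.1 this).2
    linarith
  have h3 : p * Real.exp (η / 2) + (1 - p) ≤ Real.exp (p * (η / 2 + (η / 2) ^ 2)) := by
    have := Real.add_one_le_exp (p * (η / 2 + (η / 2) ^ 2))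
    nlinarith
  have h4 : 0 ≤ p * Real.exp (η / 2) + (1 - p) := by
    have : 0 ≤ 1 - p := by linarith
    positivity
  calc _ ≤ Real.exp (-(η / 2) * m) * Real.exp (p * (η / 2 + (η / 2) ^ 2)) ^ U.card := by gcongr
    _ = _ := by
      rw [← Real.exp_nat_mul, ← Real.exp_add]
      congr 1
      simp only [m, N]
      ring

theorem setBernoulli_real_eq_bernoulliSum [Fintype V] (p : unitInterval) (S : Set (Set V))
    [DecidablePred fun A : Finset V => (A : Set V) ∈ S] :
    (setBernoulli (Set.univ : Set V) p).real S =
      bernoulliSum Finset.univ (p : ℝ) (fun A : Finset V => if (A : Set V) ∈ S then 1 else 0) := by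
  classical
  have hS : S = ⋃ (A : Finset V)
      (_ : A ∈ (Finset.univ : Finset (Finset V)).filter (fun A : Finset V => (A : Set V) ∈ S)),
      ({(A : Set V)} : Set (Set V)) := by
    ext T
    simp only [Set.mem_iUnion, Finset.mem_filter, Finset.mem_univ, true_and,
      Set.mem_singleton_iff, exists_prop]
    exact ⟨fun h => ⟨T.toFinset, by simpa using h, by simp⟩, fun ⟨A, h, e⟩ => e ▸ h⟩
  conv_lhs => rw [hS]
  rw [measureReal_biUnion_finset]
  · unfold bernoulliSum
    simp only [mul_ite, mul_one, mul_zero, Finset.powerset_univ]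
    rw [← Finset.sum_filter]
    refine Finset.sum_congr rfl fun A _ => ?_
    rw [setBernoulli_real_singleton p (Set.subset_univ _) Set.finite_univ,
      Set.ncard_coe_finset, ← Finset.coe_univ, ← Finset.coe_sdiff, Set.ncard_coe_finset,
      Finset.card_sdiff_of_subset (Finset.subset_univ _)]
  · intro A _ B _ hAB
    exact Set.disjoint_singleton.2 fun h => hAB (Finset.coe_injective h)
  · intro A _
    exact (Set.toFinite _).measurableSet

variable [DecidableEq V]

theorem bernoulliSum_insert {U : Finset V} {a : V} (ha : a ∉ U) (p : ℝ) (f : Finset V → ℝ) :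
    bernoulliSum (insert a U) p f =
      (1 - p) * bernoulliSum U p f + p * bernoulliSum U p (fun A => f (insert a A)) := by
  unfold bernoulliSum
  rw [Finset.sum_powerset_insert ha, Finset.mul_sum, Finset.mul_sum]
  congr 1
  · refine Finset.sum_congr rfl fun A hA => ?_
    have hle := Finset.card_le_card (Finset.mem_powerset.1 hA)
    rw [Finset.card_insert_of_notMem ha, Nat.succ_sub hle, pow_succ]
    ring
  · refine Finset.sum_congr rfl fun A hA => ?_
    have haA : a ∉ A := fun h => ha (Finset.mem_powerset.1 hA h)
    rw [Finset.card_insert_of_notMem ha, Finset.card_insert_of_notMem haA,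
      Nat.add_sub_add_right, pow_succ]
    ring

/-- Independence of the random set on disjoint ground sets; this is what permits exposure in rounds.
-/
theorem bernoulliSum_union {U W : Finset V} (h : Disjoint U W) (p : ℝ) (f : Finset V → ℝ) :
    bernoulliSum (U ∪ W) p f =
      bernoulliSum U p (fun A => bernoulliSum W p (fun B => f (A ∪ B))) := by
  induction W using Finset.induction_on generalizing f with
  | empty => simp [bernoulliSum_empty]
  | insert a W ha ih =>
    rw [Finset.disjoint_insert_right] at h
    have haU : a ∉ U ∪ W := by simp [h.1, ha]
    rw [Finset.union_insert, bernoulliSum_insert haU, ih h.2, ih h.2]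
    simp only [bernoulliSum_insert ha, bernoulliSum_add, bernoulliSum_mul_left,
      Finset.union_insert]

theorem bernoulliSum_indicator_le_of_disjoint {U : Finset V} {p : ℝ} (hp0 : 0 ≤ p) (hp1 : p ≤ 1)
    {S : Finset V} (hS : S ⊆ U) (P : Finset V → Prop) [DecidablePred P]
    (hP : ∀ A ⊆ U, P A → Disjoint A S) :
    bernoulliSum U p (fun A => if P A then 1 else 0) ≤ (1 - p) ^ S.card := by
  have hU : U = S ∪ (U \ S) := (Finset.union_sdiff_of_subset hS).symm
  have h1 : bernoulliSum U p (fun A => if P A then 1 else 0) ≤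
      bernoulliSum U p (fun A => if Disjoint A S then 1 else 0) := by
    refine bernoulliSum_mono hp0 hp1 fun A hA => ?_
    by_cases h : P A
    · simp [h, hP A hA h]
    · simp only [h, if_false]
      split_ifs <;> norm_num
  refine h1.trans_eq ?_
  rw [hU, bernoulliSum_union Finset.disjoint_sdiff]
  -- Writing the indicator of `A = ∅` as `0 ^ A.card` turns the outer sum into the generating
  -- function at `0`.
  have h2 : ∀ A ⊆ S, bernoulliSum (U \ S) p (fun B => if Disjoint (A ∪ B) S then (1 : ℝ) else 0) =
      (0 : ℝ) ^ A.card := by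
    intro A hA
    have h3 : ∀ B ⊆ U \ S, (if Disjoint (A ∪ B) S then (1 : ℝ) else 0) = (0 : ℝ) ^ A.card := by
      intro B hB
      have hBS : Disjoint B S := Finset.disjoint_of_subset_left hB Finset.sdiff_disjoint
      rcases A.eq_empty_or_nonempty with rfl | hne
      · simp [hBS]
      · have : ¬ Disjoint A S := fun hd => hne.ne_empty (by
          simpa using Finset.disjoint_of_subset_right hA hd)
        simp [Finset.disjoint_union_left, this, hne.ne_empty]
    rw [bernoulliSum_congr h3, bernoulliSum_const]
  rw [bernoulliSum_congr h2, bernoulliSum_pow_card]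
  simp

end BernoulliSums

/-! ### The mean of an inverse power along a uniformly random exposure. -/

section Potential

variable {V : Type*}

/-- Conditioned on its size, a `p`-random set is uniform, so a bound for uniform `k`-sets averages
over the binomial weights. -/
theorem bernoulliSum_indicator_card_le_le {U : Finset V} {p Y m : ℝ} (hp0 : 0 ≤ p) (hp1 : p ≤ 1)
    (hY : 0 ≤ Y) (P : Finset V → Prop) [DecidablePred P]
    (h : ∀ k : ℕ, (k : ℝ) ≤ m →
      ∑ A ∈ U.powersetCard k, (if P A then (1 : ℝ) else 0) ≤ U.card.choose k * Y) :
    bernoulliSum U p (fun A => if (A.card : ℝ) ≤ m ∧ P A then 1 else 0) ≤ Y := by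
  have hp1' : 0 ≤ 1 - p := by linarith
  have h0 : bernoulliSum U p (fun A => if (A.card : ℝ) ≤ m ∧ P A then 1 else 0) =
      ∑ k ∈ Finset.range (U.card + 1), ∑ A ∈ U.powersetCard k,
        p ^ A.card * (1 - p) ^ (U.card - A.card) *
          (if (A.card : ℝ) ≤ m ∧ P A then (1 : ℝ) else 0) := by
    unfold bernoulliSum
    rw [Finset.sum_powerset]
  have h1 : Y = ∑ k ∈ Finset.range (U.card + 1), p ^ k * (1 - p) ^ (U.card - k) *
      (U.card.choose k * Y) := by
    have := add_pow p (1 - p) U.card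
    rw [add_sub_cancel, one_pow] at this
    conv_lhs => rw [← one_mul Y, this, Finset.sum_mul]
    exact Finset.sum_congr rfl fun k _ => by ring
  rw [h0]
  conv_rhs => rw [h1]
  refine Finset.sum_le_sum fun k _ => ?_
  have h2 : ∑ A ∈ U.powersetCard k, p ^ A.card * (1 - p) ^ (U.card - A.card) *
        (if (A.card : ℝ) ≤ m ∧ P A then (1 : ℝ) else 0) =
      p ^ k * (1 - p) ^ (U.card - k) *
        ∑ A ∈ U.powersetCard k, (if (k : ℝ) ≤ m ∧ P A then (1 : ℝ) else 0) := by
    rw [Finset.mul_sum]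
    refine Finset.sum_congr rfl fun A hA => ?_
    rw [(Finset.mem_powersetCard.1 hA).2]
  rw [h2]
  gcongr
  by_cases hk : (k : ℝ) ≤ m
  · simpa [hk] using h k hk
  · simp only [hk, false_and, if_false, Finset.sum_const_zero]
    positivity

variable [DecidableEq V]

/-- Double counting of pairs `a ∈ B`: a uniform `(k + 1)`-set is a uniform `k`-set plus a uniform
new element. -/
theorem sum_powersetCard_succ_mul (U : Finset V) (k : ℕ) (φ : Finset V → ℝ) :
    ((k : ℝ) + 1) * ∑ B ∈ U.powersetCard (k + 1), φ B =
      ∑ A ∈ U.powersetCard k, ∑ a ∈ U \ A, φ (insert a A) := by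
  have h1 : ((k : ℝ) + 1) * ∑ B ∈ U.powersetCard (k + 1), φ B =
      ∑ B ∈ U.powersetCard (k + 1), ∑ _a ∈ B, φ B := by
    rw [Finset.mul_sum]
    refine Finset.sum_congr rfl fun B hB => ?_
    rw [Finset.sum_const, (Finset.mem_powersetCard.1 hB).2, nsmul_eq_mul]
    push_cast
    ring
  rw [h1, Finset.sum_sigma', Finset.sum_sigma']
  refine Finset.sum_bij' (fun x _ => ⟨x.1.erase x.2, x.2⟩) (fun x _ => ⟨insert x.2 x.1, x.2⟩)
    ?_ ?_ ?_ ?_ ?_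
  · rintro ⟨B, a⟩ h
    simp only [Finset.mem_sigma, Finset.mem_powersetCard, Finset.mem_sdiff] at h ⊢
    refine ⟨⟨(Finset.erase_subset _ _).trans h.1.1, ?_⟩, h.1.1 h.2, Finset.notMem_erase _ _⟩
    rw [Finset.card_erase_of_mem h.2, h.1.2]
    rfl
  · rintro ⟨A, a⟩ h
    simp only [Finset.mem_sigma, Finset.mem_powersetCard, Finset.mem_sdiff] at h ⊢
    refine ⟨⟨Finset.insert_subset h.2.1 h.1.1, ?_⟩, Finset.mem_insert_self _ _⟩
    rw [Finset.card_insert_of_notMem h.2.2, h.1.2]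
  · rintro ⟨B, a⟩ h
    simp only [Finset.mem_sigma] at h
    simp [Finset.insert_erase h.2]
  · rintro ⟨A, a⟩ h
    simp only [Finset.mem_sigma, Finset.mem_sdiff] at h
    simp [Finset.erase_insert h.2.2]
  · rintro ⟨B, a⟩ h
    simp only [Finset.mem_sigma] at h
    simp [Finset.insert_erase h.2]

/-- Truncation at `s` keeps the relative drop `v` at most `θ`, so Bernoulli's inequality `(1 - v) ^
t ≥ 1 - t v` linearises the potential. Linearity in the drop is needed because only the average drop
is controlled. -/
theorem inv_max_pow_le {x y s θ : ℝ} {t : ℕ} (hs : 0 < s) (ht : 1 ≤ t) (hθ : t * θ < 1)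
    (hxy : y ≤ x) (hd : x - y ≤ θ * s) :
    ((max y s) ^ t)⁻¹ ≤
      ((max x s) ^ t)⁻¹ * (1 + t / (1 - t * θ) * ((x - y) / max x s)) := by
  have ht' : (1 : ℝ) ≤ t := by exact_mod_cast ht
  have hκ : 0 < 1 - t * θ := by linarith
  have hM : 0 < max x s := lt_max_of_lt_right hs
  have hM' : 0 < max y s := lt_max_of_lt_right hs
  have hv : 0 ≤ (x - y) / max x s := div_nonneg (by linarith) hM.le
  rcases lt_or_ge x s with hx | hx
  · rw [max_eq_right hx.le, max_eq_right (hxy.trans hx.le)]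
    rw [max_eq_right hx.le] at hv
    have : 0 ≤ t / (1 - t * θ) * ((x - y) / s) := by positivity
    have h0 : 0 < (s ^ t)⁻¹ := by positivity
    nlinarith
  · rw [max_eq_left hx] at hv ⊢
    have hx0 : 0 < x := hs.trans_le hx
    set v := (x - y) / x with hvdef
    have hyv : y = x * (1 - v) := by rw [hvdef]; field_simp; ring
    have hvθ : v ≤ θ := by
      rw [hvdef, div_le_iff₀ hx0]
      have hθ0 : 0 ≤ θ := by
        by_contra h
        nlinarith
      nlinarith
    have htv : t * v ≤ t * θ := by gcongr
    have htv1 : 0 < 1 - t * v := by linarith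
    have hv1 : v < 1 := by nlinarith
    have h1 : 1 - t * v ≤ (1 - v) ^ t := by
      have := one_add_mul_le_pow (a := -v) (by linarith) t
      simpa [sub_eq_add_neg] using this
    have h2 : x ^ t * (1 - t * v) ≤ (max y s) ^ t := by
      calc x ^ t * (1 - t * v) ≤ x ^ t * (1 - v) ^ t := by gcongr
        _ = y ^ t := by rw [hyv, mul_pow]
        _ ≤ _ := by
          have : 0 ≤ y := by
            rw [hyv]
            exact mul_nonneg hx0.le (by linarith)
          gcongr
          exact le_max_left _ _
    calc ((max y s) ^ t)⁻¹ ≤ (x ^ t * (1 - t * v))⁻¹ := by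
          gcongr
      _ = (x ^ t)⁻¹ * (1 - t * v)⁻¹ := by rw [mul_inv]
      _ ≤ _ := by
        gcongr
        rw [inv_le_iff_one_le_mul₀ htv1]
        have h3 : 1 ≤ (1 - t * v) / (1 - t * θ) := by
          rw [le_div_iff₀ hκ]
          linarith
        have h4 : 0 ≤ t * v := by positivity
        have : (1 + t / (1 - t * θ) * v) * (1 - t * v) =
            1 - t * v + t * v * ((1 - t * v) / (1 - t * θ)) := by
          field_simp
        rw [this]
        nlinarith

/-- Going from size `k` to `k + 1` multiplies the mean potential by at most `1 + q / (|U| - k)`,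
where `q` is `t / (1 - t θ)` times `c k + 2`. The exponent sums these increments over `k`. -/
theorem sum_powersetCard_potential_le {U : Finset V} {f : Finset V → ℝ} {s D θ c m : ℝ} {t : ℕ}
    (hs : 0 < s) (ht : 1 ≤ t) (hθ : t * θ < 1) (hD : D ≤ θ * s) (hc : 0 ≤ c) (hm : m < U.card)
    (hmono : ∀ A ⊆ U, (A.card : ℝ) ≤ m → ∀ a ∈ U \ A, f (insert a A) ≤ f A)
    (hbd : ∀ A ⊆ U, (A.card : ℝ) ≤ m → ∀ a ∈ U \ A, f A - f (insert a A) ≤ D)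
    (hrate : ∀ A ⊆ U, (A.card : ℝ) ≤ m →
      ∑ a ∈ U \ A, (f A - f (insert a A)) ≤ (c * A.card + 2) * max (f A) s)
    (k : ℕ) (hk : (k : ℝ) ≤ m) :
    ∑ A ∈ U.powersetCard k, ((max (f A) s) ^ t)⁻¹ ≤
      U.card.choose k * ((max (f ∅) s) ^ t)⁻¹ *
        Real.exp (t / (1 - t * θ) * (c * k ^ 2 / 2 + 2 * k) / (U.card - m)) := by
  have hκ : 0 < 1 - t * θ := by linarith
  induction k with
  | zero => simp
  | succ k ih =>
    push_cast at hk
    have hk' : (k : ℝ) ≤ m := by linarith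
    have hkN : k < U.card := by
      have : (k : ℝ) < U.card := by linarith
      exact_mod_cast this
    have hNk : (0 : ℝ) < U.card - k := by linarith
    have hNm : (0 : ℝ) < U.card - m := by linarith
    specialize ih hk'
    set F := ∑ A ∈ U.powersetCard k, ((max (f A) s) ^ t)⁻¹
    set q : ℝ := t / (1 - t * θ) * (c * k + 2)
    have hq : 0 ≤ q := by positivity
    have hstep : ((k : ℝ) + 1) * ∑ B ∈ U.powersetCard (k + 1), ((max (f B) s) ^ t)⁻¹ ≤
        F * ((U.card - k) + q) := by
      rw [sum_powersetCard_succ_mul, Finset.sum_mul]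
      refine Finset.sum_le_sum fun A hA => ?_
      obtain ⟨hAU, hAk⟩ := Finset.mem_powersetCard.1 hA
      have hAm : (A.card : ℝ) ≤ m := by rw [hAk]; exact hk'
      have hM : 0 < max (f A) s := lt_max_of_lt_right hs
      calc ∑ a ∈ U \ A, ((max (f (insert a A)) s) ^ t)⁻¹
          ≤ ∑ a ∈ U \ A, ((max (f A) s) ^ t)⁻¹ *
              (1 + t / (1 - t * θ) * ((f A - f (insert a A)) / max (f A) s)) :=
            Finset.sum_le_sum fun a ha => inv_max_pow_le hs ht hθ (hmono A hAU hAm a ha)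
              ((hbd A hAU hAm a ha).trans hD)
        _ = ((max (f A) s) ^ t)⁻¹ * ((U.card - k) +
              t / (1 - t * θ) * ((∑ a ∈ U \ A, (f A - f (insert a A))) / max (f A) s)) := by
            rw [← Finset.mul_sum, Finset.sum_add_distrib, ← Finset.mul_sum, Finset.sum_div,
              Finset.sum_const, Finset.card_sdiff_of_subset hAU, hAk, nsmul_eq_mul,
              Nat.cast_sub hkN.le, mul_one]
        _ ≤ _ := by
            gcongr
            simp only [q]
            gcongr
            rw [div_le_iff₀ hM]
            have := hrate A hAU hAm
            rwa [hAk] at this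
    have hchoose : (U.card.choose (k + 1) : ℝ) * (k + 1) = U.card.choose k * (U.card - k) := by
      rw [← Nat.cast_sub hkN.le]
      exact_mod_cast Nat.choose_succ_right_eq U.card k
    set E : ℝ := Real.exp (t / (1 - t * θ) * (c * k ^ 2 / 2 + 2 * k) / (U.card - m))
    set E' : ℝ := Real.exp (t / (1 - t * θ) *
      (c * ((k + 1 : ℕ) : ℝ) ^ 2 / 2 + 2 * ((k + 1 : ℕ) : ℝ)) / (U.card - m))
    -- The exponents telescope because `k² / 2 + k ≤ (k + 1)² / 2`.
    have hexp : E * (1 + q / (U.card - k)) ≤ E' := by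
      have h1 : q / (U.card - k) ≤ q / (U.card - m) := by gcongr
      have h2 : 1 + q / (U.card - k) ≤ Real.exp (q / (U.card - m)) := by
        have := Real.add_one_le_exp (q / (U.card - m))
        linarith
      calc E * (1 + q / (U.card - k)) ≤ E * Real.exp (q / (U.card - m)) := by gcongr
        _ ≤ _ := by
          simp only [E, E', q]
          rw [← Real.exp_add, Real.exp_le_exp, ← add_div]
          gcongr
          rw [← mul_add]
          refine mul_le_mul_of_nonneg_left ?_ (by positivity)
          push_cast
          nlinarith
    set P := ((max (f ∅) s) ^ t)⁻¹
    have hP : 0 ≤ P := by positivity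
    have hk1 : (0 : ℝ) < k + 1 := by positivity
    refine le_of_mul_le_mul_left ?_ hk1
    calc _ ≤ F * ((U.card - k) + q) := hstep
      _ ≤ (U.card.choose k * P * E) * ((U.card - k) + q) := by gcongr
      _ = (U.card.choose k * (U.card - k)) * P * (E * (1 + q / (U.card - k))) := by
        field_simp
      _ = (U.card.choose (k + 1) * (k + 1)) * P * (E * (1 + q / (U.card - k))) := by
        rw [hchoose]
      _ ≤ (U.card.choose (k + 1) * (k + 1)) * P * E' := by gcongr
      _ = _ := by ring

end Potential

/-! ### Lower tail of a functional that decreases slowly under exposure. -/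

section Exposure

variable {V : Type*} [DecidableEq V]

set_option maxHeartbeats 800000 in
/-- If exposing one more element of a random subset of `U` decreases `f` by a factor of about
`1 - c |A| / |U|` on average, and never by more than `D`, then `f` of a `p`-random subset is
unlikely to be much smaller than `f ∅ * exp (-c p ^ 2 |U| / 2)`. -/
theorem bernoulliSum_lt_or_card_gt_le {U : Finset V} {f : Finset V → ℝ} {p η s D c L γ : ℝ}
    {t : ℕ} (hp0 : 0 ≤ p) (hp1 : p ≤ 1 / 16) (hη0 : 0 < η) (hη1 : η ≤ 1)
    (hpη : (1 + η) ^ 2 * p ≤ η) (hs : 0 < s) (ht : 1 ≤ t) (htγ : 3 ≤ t * γ) (hL : 0 ≤ L)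
    (hγ : 0 ≤ γ) (hc : 0 ≤ c) (hD : 2 * t * D ≤ η * s)
    (hN : U.card = 0 ∨ 12 * L ≤ η ^ 2 * p * U.card)
    (hmono : ∀ A ⊆ U, (A.card : ℝ) ≤ (1 + η) * p * U.card → ∀ a ∈ U \ A, f (insert a A) ≤ f A)
    (hbd : ∀ A ⊆ U, (A.card : ℝ) ≤ (1 + η) * p * U.card →
      ∀ a ∈ U \ A, f A - f (insert a A) ≤ D)
    (hrate : ∀ A ⊆ U, (A.card : ℝ) ≤ (1 + η) * p * U.card →
      ∑ a ∈ U \ A, (f A - f (insert a A)) ≤ (c * A.card + 2) * max (f A) s)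
    (hstart : s * Real.exp (γ * L + (1 + η) ^ 4 * (c / 2 * p ^ 2 * U.card) + 1) ≤ f ∅) :
    bernoulliSum U p (fun A => if f A < s ∨ (1 + η) * p * U.card < A.card then 1 else 0) ≤
      2 * Real.exp (-(3 * L)) := by
  have hexp1 : 1 ≤ Real.exp (γ * L + (1 + η) ^ 4 * (c / 2 * p ^ 2 * U.card) + 1) :=
    Real.one_le_exp (by positivity)
  have hsf : s ≤ f ∅ := by nlinarith
  rcases hN with hN | hN
  · rw [Finset.card_eq_zero] at hN
    subst hN
    rw [bernoulliSum_empty]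
    have : ¬ f ∅ < s := not_lt.2 hsf
    simp only [this, Finset.card_empty, Nat.cast_zero, mul_zero, lt_irrefl, or_self, if_false]
    positivity
  rcases Nat.eq_zero_or_pos U.card with h0 | hpos
  · rw [Finset.card_eq_zero] at h0
    subst h0
    rw [bernoulliSum_empty]
    have : ¬ f ∅ < s := not_lt.2 hsf
    simp only [this, Finset.card_empty, Nat.cast_zero, mul_zero, lt_irrefl, or_self, if_false]
    positivity
  have hNpos : (0 : ℝ) < U.card := by exact_mod_cast hpos
  have ht' : (1 : ℝ) ≤ t := by exact_mod_cast ht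
  set N : ℝ := (U.card : ℝ) with hNdef
  set m : ℝ := (1 + η) * p * N with hm
  have htθ : t * (η / (2 * t)) = η / 2 := by field_simp
  have hNm : N ≤ (1 + η) * (N - m) := by
    have : (1 + η) ^ 2 * p * N ≤ η * N := by gcongr
    simp only [hm]
    nlinarith
  have hNm0 : 0 < N - m := by
    by_contra h
    nlinarith
  have hm0 : 0 ≤ m := by positivity
  set X : ℝ := γ * L + (1 + η) ^ 4 * (c / 2 * p ^ 2 * N) + 1 with hX
  have hfpos : 0 < f ∅ := hs.trans_le hsf
  have hA : bernoulliSum U p (fun A => if (A.card : ℝ) ≤ m ∧ f A < s then 1 else 0) ≤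
      Real.exp (-(3 * L)) := by
    refine bernoulliSum_indicator_card_le_le hp0 (by linarith) (by positivity) _ fun k hk => ?_
    have hpot := sum_powersetCard_potential_le (U := U) (f := f) (θ := η / (2 * t)) (m := m)
      hs ht (by rw [htθ]; linarith)
      (by rw [div_mul_eq_mul_div, le_div_iff₀ (by positivity)]; linarith) hc (by linarith)
      hmono hbd hrate k hk
    rw [htθ, max_eq_left hsf, ← hNdef] at hpot
    -- Markov's inequality for the potential, which equals `s ^ (-t)` when `f A < s`.
    have h1 : ∀ A ∈ U.powersetCard k, (if f A < s then (1 : ℝ) else 0) ≤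
        s ^ t * ((max (f A) s) ^ t)⁻¹ := by
      intro A _
      split_ifs with h
      · rw [max_eq_right h.le, mul_inv_cancel₀ (by positivity)]
      · have : 0 < max (f A) s := lt_max_of_lt_right hs
        positivity
    refine (Finset.sum_le_sum h1).trans ?_
    rw [← Finset.mul_sum]
    refine (mul_le_mul_of_nonneg_left hpot (by positivity)).trans ?_
    -- The four factors `1 + η` come from `1 / (1 - η / 2)`, from `N / (N - m)` and twice from `m²`.
    -- The linear term contributes at most `16 p ≤ 1`.
    have h2 : t / (1 - η / 2) * (c * (k : ℝ) ^ 2 / 2 + 2 * k) / (N - m) ≤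
        t * ((1 + η) ^ 4 * (c / 2 * p ^ 2 * N) + 1) := by
      have h3 : t / (1 - η / 2) ≤ t * (1 + η) := by
        rw [div_le_iff₀ (by linarith), mul_assoc]
        have : 1 ≤ (1 + η) * (1 - η / 2) := by nlinarith
        nlinarith
      have h4 : c * (k : ℝ) ^ 2 / 2 + 2 * k ≤ c * m ^ 2 / 2 + 2 * m := by gcongr
      have h5 : (c * m ^ 2 / 2 + 2 * m) / (N - m) ≤
          (c * m ^ 2 / 2 + 2 * m) * ((1 + η) / N) := by
        rw [div_eq_mul_inv]
        refine mul_le_mul_of_nonneg_left ?_ (by positivity)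
        rw [inv_le_iff_one_le_mul₀ hNm0, div_mul_eq_mul_div, le_div_iff₀ hNpos]
        linarith
      have h6 : (1 + η) ^ 3 ≤ 8 := by
        calc (1 + η) ^ 3 ≤ (1 + 1) ^ 3 := by gcongr
          _ = 8 := by norm_num
      calc t / (1 - η / 2) * (c * (k : ℝ) ^ 2 / 2 + 2 * k) / (N - m)
          = t / (1 - η / 2) * ((c * (k : ℝ) ^ 2 / 2 + 2 * k) / (N - m)) := by ring
        _ ≤ t * (1 + η) * ((c * m ^ 2 / 2 + 2 * m) / (N - m)) := by gcongr
        _ ≤ t * (1 + η) * ((c * m ^ 2 / 2 + 2 * m) * ((1 + η) / N)) := by gcongr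
        _ = t * ((1 + η) ^ 4 * (c / 2 * p ^ 2 * N) + 2 * (1 + η) ^ 3 * p) := by
          simp only [hm]
          field_simp
        _ ≤ _ := by
          have h8 : 2 * (1 + η) ^ 3 * p ≤ 2 * 8 * (1 / 16) := by gcongr
          refine mul_le_mul_of_nonneg_left ?_ (by positivity)
          linarith
    have h7 : s ^ t * (f ∅ ^ t)⁻¹ ≤ Real.exp (-(t * X)) := by
      rw [← div_eq_mul_inv, div_le_iff₀ (by positivity)]
      have : (s * Real.exp X) ^ t ≤ f ∅ ^ t := by gcongr
      rw [mul_pow, ← Real.exp_nat_mul] at this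
      calc s ^ t = Real.exp (-(t * X)) * (s ^ t * Real.exp (t * X)) := by
            rw [mul_comm, mul_assoc, ← Real.exp_add]
            simp
        _ ≤ _ := by gcongr
    calc s ^ t * ((U.card.choose k : ℝ) * (f ∅ ^ t)⁻¹ *
          Real.exp (t / (1 - η / 2) * (c * (k : ℝ) ^ 2 / 2 + 2 * k) / (N - m)))
        = U.card.choose k * ((s ^ t * (f ∅ ^ t)⁻¹) *
          Real.exp (t / (1 - η / 2) * (c * (k : ℝ) ^ 2 / 2 + 2 * k) / (N - m))) := by ring
      _ ≤ U.card.choose k * (Real.exp (-(t * X)) *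
          Real.exp (t * ((1 + η) ^ 4 * (c / 2 * p ^ 2 * N) + 1))) := by gcongr
      _ ≤ _ := by
        gcongr
        rw [← Real.exp_add, Real.exp_le_exp, hX]
        have : 3 * L ≤ t * γ * L := mul_le_mul_of_nonneg_right htγ hL
        linarith
  have hB := bernoulliSum_card_gt_le (U := U) hp0 (by linarith) hη0.le hη1
  have hC : Real.exp (-(η ^ 2 * p * U.card / 4)) ≤ Real.exp (-(3 * L)) := by
    rw [Real.exp_le_exp]
    linarith
  have hsum : bernoulliSum U p (fun A => if f A < s ∨ m < A.card then 1 else 0) ≤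
      bernoulliSum U p (fun A => (if (A.card : ℝ) ≤ m ∧ f A < s then 1 else 0) +
        (if m < A.card then 1 else 0)) := by
    refine bernoulliSum_mono hp0 (by linarith) fun A _ => ?_
    rcases le_or_gt (A.card : ℝ) m with h | h
    · simp [h, not_lt.2 h]
    · simp [h, not_le.2 h]
  rw [bernoulliSum_add] at hsum
  linarith

end Exposure

/-! ### Elements not covered by sums and differences. -/

section Uncovered

variable {G : Type*} [AddCommGroup G] [DecidableEq G]

/-- The elements `x` of `S` that are neither a sum nor a difference of two elements of `B`. -/
def uncovered (S B : Finset G) : Finset G :=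
  {x ∈ S | ∀ y ∈ B, ∀ z ∈ B, y + z ≠ x ∧ x + y ≠ z}

/-- Adding `a` to `B` makes `x` a sum or a difference (for `x ≠ 0`). -/
def Joins (x : G) (B : Finset G) (a : G) : Prop :=
  a + a = x ∨ ∃ y ∈ B, a + y = x ∨ x + a = y ∨ x + y = a

instance (x : G) (B : Finset G) : DecidablePred (Joins x B) := fun a => by
  unfold Joins
  infer_instance

theorem mem_uncovered {S B : Finset G} {x : G} :
    x ∈ uncovered S B ↔ x ∈ S ∧ ∀ y ∈ B, ∀ z ∈ B, y + z ≠ x ∧ x + y ≠ z :=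
  Finset.mem_filter

theorem uncovered_subset (S B : Finset G) : uncovered S B ⊆ S := Finset.filter_subset _ _

theorem uncovered_empty (S : Finset G) : uncovered S ∅ = S := by simp [uncovered]

theorem uncovered_insert_subset (S B : Finset G) (a : G) :
    uncovered S (insert a B) ⊆ uncovered S B := by
  intro x hx
  simp only [uncovered, Finset.mem_filter] at hx ⊢
  exact ⟨hx.1, fun y hy z hz =>
    hx.2 y (Finset.mem_insert_of_mem hy) z (Finset.mem_insert_of_mem hz)⟩

/-- A newly covered `x` must be covered by a relation that uses `a`. The relation `x + a = a` would
force `x = 0`, hence the hypothesis on `S`. -/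
theorem joins_of_mem_uncovered {S B : Finset G} {a x : G} (hS : 0 ∉ S)
    (hx : x ∈ uncovered S B) (hx' : x ∉ uncovered S (insert a B)) : Joins x B a := by
  simp only [uncovered, Finset.mem_filter, not_and, not_forall] at hx hx'
  obtain ⟨y, hy, z, hz, h⟩ := hx' hx.1
  have hx0 : x ≠ 0 := fun h0 => hS (h0 ▸ hx.1)
  have h : y + z = x ∨ x + y = z := by tauto
  rcases Finset.mem_insert.1 hy with rfl | hyB <;>
    rcases Finset.mem_insert.1 hz with rfl | hzB
  · rcases h with h | h
    · exact Or.inl h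
    · exact absurd (add_eq_right.1 h) hx0
  · rcases h with h | h
    · exact Or.inr ⟨z, hzB, Or.inl h⟩
    · exact Or.inr ⟨z, hzB, Or.inr (Or.inl h)⟩
  · rcases h with h | h
    · exact Or.inr ⟨y, hyB, Or.inl (by rw [add_comm, h])⟩
    · exact Or.inr ⟨y, hyB, Or.inr (Or.inr h)⟩
  · have := hx.2 y hyB z hzB
    tauto

theorem card_uncovered_sub_le {S B : Finset G} (hS : 0 ∉ S) (a : G) :
    ((uncovered S B).card : ℝ) - (uncovered S (insert a B)).card ≤ 3 * B.card + 1 := by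
  have hsub : uncovered S B \ uncovered S (insert a B) ⊆
      insert (a + a) (B.image (fun y => a + y) ∪ B.image (fun y => y - a) ∪
        B.image (fun y => a - y)) := by
    intro x hx
    rw [Finset.mem_sdiff] at hx
    rcases joins_of_mem_uncovered hS hx.1 hx.2 with h | ⟨y, hy, h | h | h⟩
    · exact Finset.mem_insert.2 (Or.inl h.symm)
    · refine Finset.mem_insert_of_mem (Finset.mem_union_left _ (Finset.mem_union_left _ ?_))
      exact Finset.mem_image.2 ⟨y, hy, h⟩
    · refine Finset.mem_insert_of_mem (Finset.mem_union_left _ (Finset.mem_union_right _ ?_))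
      exact Finset.mem_image.2 ⟨y, hy, (eq_sub_of_add_eq h).symm⟩
    · refine Finset.mem_insert_of_mem (Finset.mem_union_right _ ?_)
      exact Finset.mem_image.2 ⟨y, hy, (eq_sub_of_add_eq h).symm⟩
  have h1 := Finset.card_le_card hsub
  have h2 : (insert (a + a) (B.image (fun y => a + y) ∪ B.image (fun y => y - a) ∪
        B.image (fun y => a - y))).card ≤ 3 * B.card + 1 := by
    refine (Finset.card_insert_le _ _).trans (Nat.succ_le_succ ?_)
    refine (Finset.card_union_le _ _).trans ?_
    have h3 := Finset.card_union_le (B.image (fun y => a + y)) (B.image (fun y => y - a))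
    have h4 : (B.image (fun y => a + y)).card ≤ B.card := Finset.card_image_le
    have h5 : (B.image (fun y => y - a)).card ≤ B.card := Finset.card_image_le
    have h6 : (B.image (fun y => a - y)).card ≤ B.card := Finset.card_image_le
    omega
  have h3 := Finset.card_sdiff_add_card_eq_card (uncovered_insert_subset S B a)
  have h4 : (uncovered S B).card ≤ (uncovered S (insert a B)).card + (3 * B.card + 1) := by omega
  have h5 : ((uncovered S B).card : ℝ) ≤
      (uncovered S (insert a B)).card + (3 * B.card + 1) := by exact_mod_cast h4
  linarith

/-- Exchanging the order of summation: the average drop is controlled by how many `a` cover each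
fixed `x`. -/
theorem sum_card_uncovered_sub_le {S B W : Finset G} {K : ℝ} (hS : 0 ∉ S)
    (h : ∀ x ∈ S, (({a ∈ W | Joins x B a} : Finset G).card : ℝ) ≤ K) :
    ∑ a ∈ W, (((uncovered S B).card : ℝ) - (uncovered S (insert a B)).card) ≤
      K * (uncovered S B).card := by
  have h1 : ∀ a ∈ W, ((uncovered S B).card : ℝ) - (uncovered S (insert a B)).card ≤
      ∑ x ∈ uncovered S B, if Joins x B a then (1 : ℝ) else 0 := by
    intro a _
    rw [← Finset.sum_filter, Finset.sum_const, nsmul_eq_mul, mul_one]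
    have hsub : uncovered S B \ uncovered S (insert a B) ⊆ {x ∈ uncovered S B | Joins x B a} := by
      intro x hx
      rw [Finset.mem_sdiff] at hx
      exact Finset.mem_filter.2 ⟨hx.1, joins_of_mem_uncovered hS hx.1 hx.2⟩
    have h2 := Finset.card_le_card hsub
    have h3 := Finset.card_sdiff_add_card_eq_card (uncovered_insert_subset S B a)
    have h4 : (uncovered S B).card ≤ ({x ∈ uncovered S B | Joins x B a} : Finset G).card +
      (uncovered S (insert a B)).card := by omega
    have h5 : ((uncovered S B).card : ℝ) ≤ ({x ∈ uncovered S B | Joins x B a} : Finset G).card +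
      (uncovered S (insert a B)).card := by exact_mod_cast h4
    linarith
  refine (Finset.sum_le_sum h1).trans ?_
  rw [Finset.sum_comm]
  have h2 : ∀ x ∈ uncovered S B, ∑ a ∈ W, (if Joins x B a then (1 : ℝ) else 0) ≤ K := by
    intro x hx
    rw [← Finset.sum_filter, Finset.sum_const, nsmul_eq_mul, mul_one]
    exact h x (uncovered_subset S B hx)
  refine (Finset.sum_le_sum h2).trans_eq ?_
  rw [Finset.sum_const, nsmul_eq_mul, mul_comm]

theorem card_filter_joins_le_three {U A : Finset G} {x : G}
    (hx : ({a ∈ U | a + a = x} : Finset G).card ≤ 2) :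
    ({a ∈ U \ A | Joins x A a} : Finset G).card ≤ 3 * A.card + 2 := by
  have hsub : ({a ∈ U \ A | Joins x A a} : Finset G) ⊆
      {a ∈ U | a + a = x} ∪ (A.image (fun y => x - y) ∪ A.image (fun y => y - x) ∪
        A.image (fun y => x + y)) := by
    intro a ha
    obtain ⟨haU, h⟩ := Finset.mem_filter.1 ha
    rcases h with h | ⟨y, hy, h | h | h⟩
    · exact Finset.mem_union_left _ (Finset.mem_filter.2 ⟨(Finset.mem_sdiff.1 haU).1, h⟩)
    · refine Finset.mem_union_right _ (Finset.mem_union_left _ (Finset.mem_union_left _ ?_))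
      exact Finset.mem_image.2 ⟨y, hy, (eq_sub_of_add_eq h).symm⟩
    · refine Finset.mem_union_right _ (Finset.mem_union_left _ (Finset.mem_union_right _ ?_))
      exact Finset.mem_image.2 ⟨y, hy, (eq_sub_of_add_eq' h).symm⟩
    · refine Finset.mem_union_right _ (Finset.mem_union_right _ ?_)
      exact Finset.mem_image.2 ⟨y, hy, h⟩
  refine (Finset.card_le_card hsub).trans ((Finset.card_union_le _ _).trans ?_)
  have h2 := Finset.card_union_le (A.image (fun y => x - y) ∪ A.image (fun y => y - x))
    (A.image (fun y => x + y))
  have h3 := Finset.card_union_le (A.image (fun y => x - y)) (A.image (fun y => y - x))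
  have h4 : (A.image (fun y => x - y)).card ≤ A.card := Finset.card_image_le
  have h5 : (A.image (fun y => y - x)).card ≤ A.card := Finset.card_image_le
  have h6 : (A.image (fun y => x + y)).card ≤ A.card := Finset.card_image_le
  omega

/-- For an involution `x`, `y - x = y + x`. Involutions `y ∈ C` from an earlier round join `x` only
to `x + y`, which lies outside `U`, so `C` costs nothing. -/
theorem card_filter_joins_le_two {U A C : Finset G} {x : G} (hx : x = -x) (h2 : ∀ a, a + a ≠ x)
    (hC : ∀ y ∈ C, y = -y) (hCU : ∀ y ∈ C, ∀ a ∈ U, x + y ≠ a) :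
    ({a ∈ U \ A | Joins x (C ∪ A) a} : Finset G).card ≤ 2 * A.card := by
  have hsub : ({a ∈ U \ A | Joins x (C ∪ A) a} : Finset G) ⊆
      A.image (fun y => x - y) ∪ A.image (fun y => x + y) := by
    intro a ha
    obtain ⟨haU, h⟩ := Finset.mem_filter.1 ha
    have haU := (Finset.mem_sdiff.1 haU).1
    rcases h with h | ⟨y, hy, h⟩
    · exact absurd h (h2 a)
    have h' : x - y = a ∨ x + y = a := by
      rcases h with h | h | h
      · exact Or.inl (eq_sub_of_add_eq h).symm
      · refine Or.inr ?_
        conv_lhs => rw [hx, ← h]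
        abel
      · exact Or.inr h
    rcases Finset.mem_union.1 hy with hyC | hyA
    · refine absurd ?_ (hCU y hyC a haU)
      rcases h' with h' | h'
      · conv_lhs => rw [hC y hyC]
        rw [← sub_eq_add_neg, h']
      · exact h'
    · rcases h' with h' | h'
      · exact Finset.mem_union_left _ (Finset.mem_image.2 ⟨y, hyA, h'⟩)
      · exact Finset.mem_union_right _ (Finset.mem_image.2 ⟨y, hyA, h'⟩)
  have h3 := (Finset.card_le_card hsub).trans (Finset.card_union_le _ _)
  have h4 : (A.image (fun y => x - y)).card ≤ A.card := Finset.card_image_le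
  have h5 : (A.image (fun y => x + y)).card ≤ A.card := Finset.card_image_le
  omega

/-- Among involutions, `x - y`, `y - x` and `x + y` coincide. -/
theorem card_filter_joins_le_one {U A : Finset G} {x : G} (hx : x = -x) (h2 : ∀ a, a + a ≠ x)
    (hU : ∀ a ∈ U, a = -a) (hA : A ⊆ U) :
    ({a ∈ U \ A | Joins x A a} : Finset G).card ≤ A.card := by
  have hsub : ({a ∈ U \ A | Joins x A a} : Finset G) ⊆ A.image (fun y => x + y) := by
    intro a ha
    obtain ⟨haU, h⟩ := Finset.mem_filter.1 ha
    rcases h with h | ⟨y, hy, h | h | h⟩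
    · exact absurd h (h2 a)
    · refine Finset.mem_image.2 ⟨y, hy, ?_⟩
      conv_lhs => rw [hU y (hA hy), ← h]
      abel
    · refine Finset.mem_image.2 ⟨y, hy, ?_⟩
      conv_lhs => rw [hx, ← h]
      abel
    · exact Finset.mem_image.2 ⟨y, hy, h⟩
  exact (Finset.card_le_card hsub).trans Finset.card_image_le

/-- Exposing a `p`-random subset of `U₁ ∪ U₂` in two rounds leaves many uncovered elements. -/
theorem bernoulliSum_card_uncovered_lt_le {U₁ U₂ S : Finset G} {p η s L γ c₁ c₂ : ℝ} {t : ℕ}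
    (hdisj : Disjoint U₁ U₂) (hS : 0 ∉ S)
    (hp0 : 0 ≤ p) (hp1 : p ≤ 1 / 16) (hη0 : 0 < η) (hη1 : η ≤ 1)
    (hpη : (1 + η) ^ 2 * p ≤ η) (hs : 0 < s) (ht : 1 ≤ t) (htγ : 3 ≤ t * γ) (hL : 0 ≤ L)
    (hγ : 0 ≤ γ) (hc₁ : 0 ≤ c₁) (hc₂ : 0 ≤ c₂)
    (hD : 2 * t * (3 * ((1 + η) * p * (U₁.card + U₂.card)) + 1) ≤ η * s)
    (hN₁ : U₁.card = 0 ∨ 12 * L ≤ η ^ 2 * p * U₁.card)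
    (hN₂ : U₂.card = 0 ∨ 12 * L ≤ η ^ 2 * p * U₂.card)
    (hrate₁ : ∀ x ∈ S, ∀ A ⊆ U₁,
      (({a ∈ U₁ \ A | Joins x A a} : Finset G).card : ℝ) ≤ c₁ * A.card + 2)
    (hrate₂ : ∀ x ∈ S, ∀ C ⊆ U₁, ∀ A ⊆ U₂,
      (({a ∈ U₂ \ A | Joins x (C ∪ A) a} : Finset G).card : ℝ) ≤ c₂ * A.card + 2)
    (hstart : s * Real.exp (2 * γ * L +
      (1 + η) ^ 4 * (p ^ 2 * ((c₁ * U₁.card + c₂ * U₂.card) / 2)) + 2) ≤ S.card) :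
    bernoulliSum (U₁ ∪ U₂) p (fun B => if ((uncovered S B).card : ℝ) < s then 1 else 0) ≤
      4 * Real.exp (-(3 * L)) := by
  -- The target for the first round is exactly what the second round needs as its starting value.
  set s₁ : ℝ := s * Real.exp (γ * L + (1 + η) ^ 4 * (c₂ / 2 * p ^ 2 * U₂.card) + 1) with hs₁
  have hss₁ : s ≤ s₁ :=
    le_mul_of_one_le_right hs.le (Real.one_le_exp (by positivity))
  set D : ℝ := 3 * ((1 + η) * p * (U₁.card + U₂.card)) + 1 with hDdef
  have hp1' : p ≤ 1 := by linarith
  have hround₁ : bernoulliSum U₁ p (fun A => if ((uncovered S A).card : ℝ) < s₁ ∨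
      (1 + η) * p * U₁.card < A.card then 1 else 0) ≤ 2 * Real.exp (-(3 * L)) := by
    refine bernoulliSum_lt_or_card_gt_le (t := t) (D := D) (c := c₁) (γ := γ) hp0 hp1 hη0 hη1 hpη
      (hs.trans_le hss₁) ht htγ hL hγ hc₁ ?_ hN₁ ?_ ?_ ?_ ?_
    · exact hD.trans (mul_le_mul_of_nonneg_left hss₁ hη0.le)
    · intro A _ _ a _
      exact_mod_cast Finset.card_le_card (uncovered_insert_subset S A a)
    · intro A _ hA a _
      refine (card_uncovered_sub_le hS a).trans ?_
      have : 0 ≤ (1 + η) * p * U₂.card := by positivity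
      simp only [hDdef]
      linarith
    · intro A hAU _
      refine (sum_card_uncovered_sub_le hS fun x hx => hrate₁ x hx A hAU).trans ?_
      gcongr
      exact le_max_left _ _
    · rw [uncovered_empty]
      refine le_trans (le_of_eq ?_) hstart
      rw [hs₁, mul_assoc, ← Real.exp_add]
      congr 2
      ring
  have hround₂ : ∀ A₁ ⊆ U₁, bernoulliSum U₂ p
      (fun A => if ((uncovered S (A₁ ∪ A)).card : ℝ) < s then 1 else 0) ≤
      (if ((uncovered S A₁).card : ℝ) < s₁ ∨ (1 + η) * p * U₁.card < A₁.card then 1 else 0) +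
        2 * Real.exp (-(3 * L)) := by
    intro A₁ hA₁
    split_ifs with hbad
    · have h1 : bernoulliSum U₂ p
          (fun A => if ((uncovered S (A₁ ∪ A)).card : ℝ) < s then 1 else 0) ≤
          bernoulliSum U₂ p (fun _ => 1) := by
        refine bernoulliSum_mono hp0 hp1' fun A _ => ?_
        split_ifs <;> norm_num
      rw [bernoulliSum_const] at h1
      have := Real.exp_pos (-(3 * L))
      linarith
    · rw [zero_add]
      push Not at hbad
      refine le_trans ?_ (bernoulliSum_lt_or_card_gt_le
        (f := fun A => ((uncovered S (A₁ ∪ A)).card : ℝ)) (t := t) (D := D) (c := c₂) (γ := γ)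
        hp0 hp1 hη0 hη1 hpη hs ht htγ hL hγ hc₂ hD hN₂ ?_ ?_ ?_ ?_)
      · refine bernoulliSum_mono hp0 hp1' fun A _ => ?_
        by_cases h : ((uncovered S (A₁ ∪ A)).card : ℝ) < s
        · simp [h]
        · simp only [h, if_false]
          split_ifs <;> norm_num
      · intro A _ _ a _
        rw [Finset.union_insert]
        exact_mod_cast Finset.card_le_card (uncovered_insert_subset S _ a)
      · intro A _ hA a _
        rw [Finset.union_insert]
        refine (card_uncovered_sub_le hS a).trans ?_
        have h1 : ((A₁ ∪ A).card : ℝ) ≤ A₁.card + A.card := by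
          exact_mod_cast Finset.card_union_le A₁ A
        simp only [hDdef]
        linarith [hbad.2]
      · intro A hAU _
        simp only [Finset.union_insert]
        refine (sum_card_uncovered_sub_le hS fun x hx => hrate₂ x hx A₁ hA₁ A hAU).trans ?_
        gcongr
        exact le_max_left _ _
      · rw [Finset.union_empty]
        exact hbad.1
  rw [bernoulliSum_union hdisj]
  have h := bernoulliSum_mono hp0 hp1' hround₂
  rw [bernoulliSum_add, bernoulliSum_const] at h
  linarith

/-- Every covered element is a sum or a difference of one of the `|B|²` ordered pairs. This suffices
when `p` is so small that `|B|²` is below a fraction of `n`. -/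
theorem card_sub_le_card_uncovered (S B : Finset G) :
    (S.card : ℝ) - 2 * (B.card : ℝ) ^ 2 ≤ (uncovered S B).card := by
  have hsub : S \ uncovered S B ⊆ (B ×ˢ B).image (fun q => q.1 + q.2) ∪
      (B ×ˢ B).image (fun q => q.2 - q.1) := by
    intro x hx
    simp only [uncovered, Finset.mem_sdiff, Finset.mem_filter, not_and, not_forall] at hx
    obtain ⟨y, hy, z, hz, h⟩ := hx.2 hx.1
    have h : y + z = x ∨ x + y = z := by tauto
    rcases h with h | h
    · exact Finset.mem_union_left _ (Finset.mem_image.2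
        ⟨(y, z), Finset.mem_product.2 ⟨hy, hz⟩, h⟩)
    · exact Finset.mem_union_right _ (Finset.mem_image.2
        ⟨(y, z), Finset.mem_product.2 ⟨hy, hz⟩, (eq_sub_of_add_eq h).symm⟩)
  have h1 := (Finset.card_le_card hsub).trans (Finset.card_union_le _ _)
  have h2 : ((B ×ˢ B).image (fun q : G × G => q.1 + q.2)).card ≤ B.card * B.card :=
    Finset.card_image_le.trans_eq (Finset.card_product _ _)
  have h3 : ((B ×ˢ B).image (fun q : G × G => q.2 - q.1)).card ≤ B.card * B.card :=
    Finset.card_image_le.trans_eq (Finset.card_product _ _)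
  have h4 := Finset.card_sdiff_add_card_eq_card (uncovered_subset S B)
  have h5 : S.card ≤ 2 * (B.card * B.card) + (uncovered S B).card := by omega
  have h6 : (S.card : ℝ) ≤ 2 * (B.card * B.card) + (uncovered S B).card := by exact_mod_cast h5
  nlinarith

/-- The random set is unlikely to miss every element that could be added to its odd part. -/
theorem setBernoulli_inter_mem_SF_le [Fintype G] {O S : Finset G}
    (hpar : ∀ x y, x + y ∈ O ↔ (x ∈ O ↔ y ∉ O)) (hSO : Disjoint S O) (hS : 0 ∉ S)
    (p : unitInterval) {s : ℝ} :
    (setBernoulli (Set.univ : Set G) p).real {A | A ∩ (O : Set G) ∈ SF A} ≤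
      bernoulliSum O (p : ℝ) (fun B => if ((uncovered S B).card : ℝ) < s then 1 else 0) +
        Real.exp (-(p * s)) := by
  classical
  have hp0 : 0 ≤ (p : ℝ) := p.2.1
  have hp1 : (p : ℝ) ≤ 1 := p.2.2
  rw [setBernoulli_real_eq_bernoulliSum, ← Finset.union_compl O,
    bernoulliSum_union disjoint_compl_right]
  have hinner : ∀ B ⊆ O, bernoulliSum Oᶜ (p : ℝ) (fun C =>
      if ((B ∪ C : Finset G) : Set G) ∈ {A | A ∩ (O : Set G) ∈ SF A} then 1 else 0) ≤
      (if ((uncovered S B).card : ℝ) < s then 1 else 0) + Real.exp (-(p * s)) := by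
    intro B hB
    have hsub : uncovered S B ⊆ Oᶜ := fun x hx => Finset.mem_compl.2
      (Finset.disjoint_left.1 hSO (uncovered_subset S B hx))
    have h1 := bernoulliSum_indicator_le_of_disjoint hp0 hp1 hsub
      (fun C => ((B ∪ C : Finset G) : Set G) ∈ {A | A ∩ (O : Set G) ∈ SF A}) ?_
    · refine h1.trans ?_
      split_ifs with h
      · have h2 : (1 - (p : ℝ)) ^ (uncovered S B).card ≤ 1 :=
          pow_le_one₀ (by linarith) (by linarith)
        have := Real.exp_pos (-(p * s))
        linarith
      · rw [zero_add]
        push Not at h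
        calc (1 - (p : ℝ)) ^ (uncovered S B).card
            ≤ Real.exp (-p) ^ (uncovered S B).card := by
              refine pow_le_pow_left₀ (by linarith) ?_ _
              have := Real.add_one_le_exp (-(p : ℝ))
              linarith
          _ = Real.exp (-(p * (uncovered S B).card)) := by
              rw [← Real.exp_nat_mul]
              congr 1
              ring
          _ ≤ _ := by gcongr
    · intro C hC hSF
      rw [Finset.disjoint_right]
      intro x hx hxC
      simp only [Set.mem_ofPred_eq] at hSF
      have hxO : x ∉ O := Finset.mem_compl.1 (hsub hx)
      have hint : ((B ∪ C : Finset G) : Set G) ∩ (O : Set G) = B := by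
        ext y
        simp only [Finset.coe_union, Set.mem_inter_iff, Set.mem_union, Finset.mem_coe]
        constructor
        · rintro ⟨h | h, hO⟩
          · exact h
          · exact absurd hO (Finset.mem_compl.1 (hC h))
        · exact fun h => ⟨Or.inl h, hB h⟩
      rw [hint] at hSF
      obtain ⟨-, -, hmax⟩ := hSF
      have hxB : x ∉ B := fun h => hxO (hB h)
      have hx' := mem_uncovered.1 hx
      have hx0 : x ≠ 0 := fun h => hS (h ▸ hx'.1)
      -- Parity excludes odd + odd = odd, even + even = odd and even + odd = even; the other
      -- relations contradict `x ≠ 0` or `x` being uncovered.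
      have hfree : IsSumFree ((insert x B : Finset G) : Set G) := by
        intro y hy z hz hyz
        simp only [Finset.coe_insert, Set.mem_insert_iff, Finset.mem_coe] at hy hz hyz
        have hparB : ∀ y ∈ B, y ∈ O := fun y hy => hB hy
        rcases hy with rfl | hy <;> rcases hz with rfl | hz
        · rcases hyz with h | h
          · exact hx0 (add_eq_left.1 h)
          · have := (hpar _ _).1 (hB h)
            tauto
        · rcases hyz with h | h
          · have := (hpar y z).2 (by simp [hxO, hB hz])
            rw [h] at this
            exact hxO this
          · exact (hx'.2 z hz _ h).2 rfl
        · rcases hyz with h | h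
          · have := (hpar y z).2 (by simp [hxO, hB hy])
            rw [h] at this
            exact hxO this
          · exact (hx'.2 y hy _ h).2 (add_comm _ _)
        · rcases hyz with h | h
          · exact (hx'.2 y hy z hz).1 h
          · have := (hpar y z).1 (hB h)
            have h1 := hB hy
            have h2 := hB hz
            tauto
      have := hmax _ (by
        intro y hy
        simp only [Finset.coe_insert, Set.mem_insert_iff, Finset.mem_coe, Finset.coe_union,
          Set.mem_union] at hy ⊢
        rcases hy with rfl | hy
        · exact Or.inr hxC
        · exact Or.inl hy) hfree
      rw [Set.ncard_coe_finset, Set.ncard_coe_finset, Finset.card_insert_of_notMem hxB] at this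
      omega
  have h := bernoulliSum_mono hp0 hp1 hinner
  rw [bernoulliSum_add, bernoulliSum_const] at h
  exact h

end Uncovered

/-! ### Maximum sum-free sets in groups of even order. -/

section OddCosets

variable {G : Type*} [AddCommGroup G]

/-- By Cauchy's theorem doubling is not injective, hence not surjective. So `G / 2G` is a nonzero
vector space over `ZMod 2` and has a nonzero functional. -/
theorem exists_addMonoidHom_zmod_two_ne_zero [Finite G] (h : 2 ∣ Nat.card G) :
    ∃ φ : G →+ ZMod 2, ∃ t, φ t = 1 := by
  have h01 : ∀ z : ZMod 2, z ≠ 0 → z = 1 := by decide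
  have : Fact (Nat.Prime 2) := ⟨Nat.prime_two⟩
  obtain ⟨a, ha⟩ := exists_prime_addOrderOf_dvd_card' (G := G) 2 h
  set d : G →+ G := nsmulAddMonoidHom 2 with hd
  have hsurj : ¬ Function.Surjective d := by
    intro hs
    have hinj := Finite.injective_iff_surjective.2 hs
    have h0 : d a = d 0 := by
      have := addOrderOf_nsmul_eq_zero a
      rw [ha] at this
      simp [hd, this]
    have : a = 0 := hinj h0
    simp [this] at ha
  obtain ⟨t, ht⟩ := not_forall.1 hsurj
  let _ : Module (ZMod 2) (G ⧸ d.range) := QuotientAddGroup.zmodModule (n := 2) fun x => ⟨x, rfl⟩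
  have hne : (QuotientAddGroup.mk t : G ⧸ d.range) ≠ 0 := by
    rw [Ne, QuotientAddGroup.eq_zero_iff]
    exact fun h => ht h
  have := mt (Module.forall_dual_apply_eq_zero_iff (ZMod 2)
    (QuotientAddGroup.mk t : G ⧸ d.range)).1 hne
  obtain ⟨f, hf⟩ := not_forall.1 this
  refine ⟨f.toAddMonoidHom.comp (QuotientAddGroup.mk' d.range), t, ?_⟩
  exact h01 _ hf

theorem exists_isSumFree_two_mul_ncard [Finite G] (h : 2 ∣ Nat.card G) :
    ∃ T : Set G, IsSumFree T ∧ 2 * T.ncard = Nat.card G := by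
  obtain ⟨φ, t, ht⟩ := exists_addMonoidHom_zmod_two_ne_zero h
  have h01 : ∀ z : ZMod 2, 1 + z = 1 ↔ ¬ z = 1 := by decide
  refine ⟨{x | φ x = 1}, ?_, ?_⟩
  · intro x hx y hy hxy
    simp only [Set.mem_ofPred_eq, map_add] at hx hy hxy
    rw [hx, h01] at hxy
    exact hxy hy
  · have hc : {x | φ x = 1}ᶜ = (fun x => t + x) ⁻¹' {x | φ x = 1} := by
      ext x
      simp [ht, h01]
    have h1 : ({x | φ x = 1}ᶜ : Set G).ncard = {x | φ x = 1}.ncard := by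
      rw [hc]
      exact Set.ncard_preimage_of_injective_subset_range (add_right_injective t)
        fun x _ => ⟨-t + x, by simp⟩
    have := Set.ncard_add_ncard_compl {x | φ x = 1}
    omega

/-- For `b ∈ O` the translate `b + O` avoids `O`, so `|O|` is at most half of `|G|`; maximality
gives equality, so `b + O` is the complement. This is the parity rule for an odd summand, and it
extends to even ones by adding a fixed odd element. -/
theorem two_mul_ncard_and_add_mem_iff_of_mem_SF [Finite G] (h : 2 ∣ Nat.card G) {O : Set G}
    (hO : O ∈ SF (Set.univ : Set G)) :
    2 * O.ncard = Nat.card G ∧ ∀ x y, x + y ∈ O ↔ (x ∈ O ↔ y ∉ O) := by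
  obtain ⟨-, hfree, hmax⟩ := hO
  obtain ⟨T, hT, hTc⟩ := exists_isSumFree_two_mul_ncard h
  have hle := hmax T (Set.subset_univ _) hT
  have hpos : 0 < Nat.card G := Nat.card_pos
  have hne : O.Nonempty := by
    rw [Set.nonempty_iff_ne_empty]
    rintro rfl
    simp at hle
    omega
  have hcompl := Set.ncard_add_ncard_compl O
  have hsub : ∀ b ∈ O, (fun x => b + x) '' O ⊆ Oᶜ := by
    rintro b hb _ ⟨x, hx, rfl⟩
    exact hfree b hb x hx
  have himg : ∀ b, ((fun x => b + x) '' O).ncard = O.ncard := fun b =>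
    Set.ncard_image_of_injective _ (add_right_injective b)
  obtain ⟨b₀, hb₀⟩ := hne
  have h1 := Set.ncard_le_ncard (hsub b₀ hb₀) (Set.toFinite _)
  rw [himg] at h1
  have hcard : 2 * O.ncard = Nat.card G := by omega
  have hadd : ∀ b ∈ O, ∀ x, b + x ∈ O ↔ x ∉ O := by
    intro b hb x
    have heq : (fun x => b + x) '' O = Oᶜ := by
      refine Set.eq_of_subset_of_ncard_le (hsub b hb) ?_ (Set.toFinite _)
      rw [himg]
      omega
    have : b + x ∈ (fun x => b + x) '' O ↔ x ∈ O := (add_right_injective b).mem_set_image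
    rw [heq, Set.mem_compl_iff] at this
    tauto
  refine ⟨hcard, fun x y => ?_⟩
  by_cases hx : x ∈ O
  · simp [hx, hadd x hx y]
  · have h2 := hadd b₀ hb₀ (x + y)
    have h3 := hadd (b₀ + x) ((hadd b₀ hb₀ x).2 hx) y
    rw [add_assoc] at h3
    tauto

end OddCosets

/-! ### Counting involutions, doubles and halves. -/

section Involutions

variable {G : Type*} [AddCommGroup G] [DecidableEq G] [Fintype G]

theorem card_filter_two_lt_card_halves_le {O : Finset G} :
    3 * ({x | 2 < ({a ∈ O | a + a = x} : Finset G).card} : Finset G).card ≤ O.card := by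
  have h1 : ({x | 2 < ({a ∈ O | a + a = x} : Finset G).card} : Finset G).card * 3 ≤
      ∑ x ∈ ({x | 2 < ({a ∈ O | a + a = x} : Finset G).card} : Finset G),
        ({a ∈ O | a + a = x} : Finset G).card := by
    rw [← smul_eq_mul]
    refine Finset.card_nsmul_le_sum _ _ _ fun x hx => ?_
    exact (Finset.mem_filter.1 hx).2
  have h2 : ∑ x ∈ ({x | 2 < ({a ∈ O | a + a = x} : Finset G).card} : Finset G),
        ({a ∈ O | a + a = x} : Finset G).card ≤
      ∑ x : G, ({a ∈ O | a + a = x} : Finset G).card :=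
    Finset.sum_le_sum_of_subset (Finset.subset_univ _)
  have h3 : O.card = ∑ x : G, ({a ∈ O | a + a = x} : Finset G).card :=
    Finset.card_eq_sum_card_fiberwise fun _ _ => Finset.mem_coe.2 (Finset.mem_univ _)
  omega

/-- The sets of halves of distinct `x` are disjoint, so at most a third of `|O|` many `x` have three
or more halves in `O`. -/
theorem two_mul_card_le_card_few_halves {O : Finset G} (hO : 2 * O.card = Nat.card G) :
    2 * O.card ≤ 3 * ({x | x ∉ O ∧ x ≠ 0 ∧
      ({a ∈ O | a + a = x} : Finset G).card ≤ 2} : Finset G).card + 3 := by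
  have hsub : Oᶜ ⊆ ({x | x ∉ O ∧ x ≠ 0 ∧
      ({a ∈ O | a + a = x} : Finset G).card ≤ 2} : Finset G) ∪
      ({x | 2 < ({a ∈ O | a + a = x} : Finset G).card} : Finset G) ∪ {0} := by
    intro x hx
    simp only [Finset.mem_compl] at hx
    simp only [Finset.mem_union, Finset.mem_filter, Finset.mem_univ, true_and,
      Finset.mem_singleton]
    by_cases h0 : x = 0
    · exact Or.inr h0
    · rcases le_or_gt ({a ∈ O | a + a = x} : Finset G).card 2 with h | h
      · exact Or.inl (Or.inl ⟨hx, h0, h⟩)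
      · exact Or.inl (Or.inr h)
  have h1 := (Finset.card_le_card hsub).trans (Finset.card_union_le _ _)
  have h2 := Finset.card_union_le ({x | x ∉ O ∧ x ≠ 0 ∧
      ({a ∈ O | a + a = x} : Finset G).card ≤ 2} : Finset G)
      ({x | 2 < ({a ∈ O | a + a = x} : Finset G).card} : Finset G)
  have h3 := card_filter_two_lt_card_halves_le (O := O)
  have h4 : Oᶜ.card = O.card := by
    have := Finset.card_add_card_compl O
    rw [Nat.card_eq_fintype_card] at hO
    omega
  simp only [Finset.card_singleton] at h1
  omega

/-- The involutions form the kernel of doubling. -/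
theorem card_range_double_mul :
    (Finset.univ.image (fun a : G => a + a)).card * ({x | x = -x} : Finset G).card =
      Nat.card G := by
  set d : G →+ G := nsmulAddMonoidHom 2 with hd
  have hda : ∀ a, d a = a + a := fun a => by simp [hd, two_nsmul]
  have h1 : Nat.card d.ker = ({x | x = -x} : Finset G).card := by
    rw [← Nat.card_eq_finsetCard]
    refine Nat.card_congr (Equiv.subtypeEquivRight fun x => ?_)
    simp [AddMonoidHom.mem_ker, hda, eq_neg_iff_add_eq_zero]
  have h2 : Nat.card d.range = (Finset.univ.image (fun a : G => a + a)).card := by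
    rw [← Nat.card_eq_finsetCard]
    refine Nat.card_congr (Equiv.subtypeEquivRight fun x => ?_)
    simp [AddMonoidHom.mem_range, hda]
  rw [← h1, ← h2, ← AddSubgroup.index_ker, mul_comm]
  exact AddSubgroup.card_mul_index _

theorem card_involutions_eq_or_le {n : ℕ} (h : Nat.card G = 2 * n) :
    (∀ x : G, x = -x) ∨ ({x | x = -x} : Finset G).card ≤ n := by
  have h1 := card_range_double_mul (G := G)
  rw [h] at h1
  set k := (Finset.univ.image (fun a : G => a + a)).card with hk
  rcases Nat.lt_or_ge 1 k with h2 | h2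
  · right
    nlinarith
  · left
    intro x
    rw [eq_neg_iff_add_eq_zero]
    exact Finset.card_le_one.1 h2 _ (Finset.mem_image_of_mem _ (Finset.mem_univ x)) _
      (by simpa using Finset.mem_image_of_mem (fun a : G => a + a) (Finset.mem_univ 0))

/-- If some odd involution exists, translation by it maps odd involutions injectively to even ones.
-/
theorem card_involutions_odd_le_even {O : Finset G} (hpar : ∀ x y, x + y ∈ O ↔ (x ∈ O ↔ y ∉ O)) :
    ({x ∈ O | x = -x} : Finset G).card ≤ ({x ∈ Oᶜ | x = -x} : Finset G).card := by
  rcases ({x ∈ O | x = -x} : Finset G).eq_empty_or_nonempty with h | ⟨b, hb⟩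
  · simp [h]
  · obtain ⟨hbO, hb⟩ := Finset.mem_filter.1 hb
    refine Finset.card_le_card_of_injOn (fun x => b + x) ?_ (add_right_injective b).injOn
    intro x hx
    obtain ⟨hxO, hx⟩ := Finset.mem_filter.1 (Finset.mem_coe.1 hx)
    refine Finset.mem_coe.2 (Finset.mem_filter.2 ⟨Finset.mem_compl.2 fun h => ?_, ?_⟩)
    · exact ((hpar b x).1 h).1 hbO hxO
    · rw [neg_add, ← hb, ← hx]

/-- The even involutions that are not of the form `a + a`. -/
theorem card_involutions_le_card_even_not_double {O : Finset G}
    (hpar : ∀ x y, x + y ∈ O ↔ (x ∈ O ↔ y ∉ O)) :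
    ({x | x = -x} : Finset G).card ≤
      2 * ({x | x ∉ O ∧ x = -x ∧ ∀ a, a + a ≠ x} : Finset G).card +
        2 * (Finset.univ.image (fun a : G => a + a)).card := by
  have h1 : ({x | x = -x} : Finset G) = {x ∈ O | x = -x} ∪ {x ∈ Oᶜ | x = -x} := by
    rw [← Finset.filter_union, Finset.union_compl]
  have h2 := Finset.card_union_le ({x ∈ O | x = -x} : Finset G) {x ∈ Oᶜ | x = -x}
  have h3 := card_involutions_odd_le_even hpar
  have hsub : ({x ∈ Oᶜ | x = -x} : Finset G) ⊆
      ({x | x ∉ O ∧ x = -x ∧ ∀ a, a + a ≠ x} : Finset G) ∪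
      Finset.univ.image (fun a : G => a + a) := by
    intro x hx
    obtain ⟨hxO, hx⟩ := Finset.mem_filter.1 hx
    by_cases h : ∀ a, a + a ≠ x
    · exact Finset.mem_union_left _ (Finset.mem_filter.2
        ⟨Finset.mem_univ _, Finset.mem_compl.1 hxO, hx, h⟩)
    · push Not at h
      obtain ⟨a, ha⟩ := h
      exact Finset.mem_union_right _ (Finset.mem_image.2 ⟨a, Finset.mem_univ _, ha⟩)
  have h4 := (Finset.card_le_card hsub).trans (Finset.card_union_le _ _)
  rw [h1]
  omega

end Involutions

/-! ### Comparison of logarithms and powers of `n`. -/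

section Asymptotics

theorem eventually_mul_log_le_exp (A : ℝ) {b : ℝ} (hb : 0 < b) :
    ∀ᶠ n : ℕ in atTop, A * Real.log n ≤ Real.exp (b * Real.log n) := by
  have h1 : ∀ᶠ x : ℝ in atTop, A * x ≤ Real.exp (b * x) := by
    have h2 := (isLittleO_pow_exp_pos_mul_atTop 1 hb).bound
      (show (0 : ℝ) < 1 / (|A| + 1) by positivity)
    filter_upwards [h2, eventually_ge_atTop 0] with x hx hx0
    rw [pow_one, Real.norm_of_nonneg hx0, Real.norm_of_nonneg (Real.exp_pos _).le,
      div_mul_eq_mul_div, one_mul, le_div_iff₀ (by positivity)] at hx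
    have := le_abs_self A
    nlinarith
  exact (Real.tendsto_log_atTop.comp tendsto_natCast_atTop_atTop).eventually h1

theorem exp_neg_three_mul_log {n : ℕ} (hn : 0 < n) :
    Real.exp (-(3 * Real.log n)) = 1 / (n : ℝ) ^ 3 := by
  have hn' : (0 : ℝ) < n := by exact_mod_cast hn
  have : (3 : ℝ) * Real.log n = ((3 : ℕ) : ℝ) * Real.log n := by norm_num
  rw [Real.exp_neg, this, Real.exp_nat_mul, Real.exp_log hn', one_div]

theorem five_mul_exp_neg_three_mul_log_le {n : ℕ} (hn : 5 ≤ n) :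
    5 * Real.exp (-(3 * Real.log n)) ≤ 1 / (n : ℝ) ^ 2 := by
  have hn' : (5 : ℝ) ≤ n := by exact_mod_cast hn
  rw [exp_neg_three_mul_log (by omega), mul_one_div, div_le_div_iff₀ (by positivity)
    (by positivity)]
  nlinarith [pow_pos (show (0 : ℝ) < n by linarith) 2]

end Asymptotics

/-! ### The probability bound for very small `p` and for larger `p`. -/

section Thresholds

universe u

/-- Unless `B` is more than twice its mean size, `|B| ≤ √n / 2`, so at most `n / 2` elements are
covered and at least `n / 4` stay uncovered. -/
theorem setBernoulli_inter_mem_SF_le_of_small {G : Type u} [AddCommGroup G] [DecidableEq G]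
    [Fintype G] {O : Finset G} {n : ℕ} (hn : 5 ≤ n) (hOn : O.card = n) (hG : Nat.card G = 2 * n)
    (hpar : ∀ x y, x + y ∈ O ↔ (x ∈ O ↔ y ∉ O)) (p : unitInterval)
    (hp : (p : ℝ) * √n ≤ 1 / 4) (hpn : 12 * Real.log n ≤ p * n) :
    (setBernoulli (Set.univ : Set G) p).real {A | A ∩ (O : Set G) ∈ SF A} ≤
      1 / (n : ℝ) ^ 2 := by
  have hn' : (5 : ℝ) ≤ n := by exact_mod_cast hn
  have hp0 : 0 ≤ (p : ℝ) := p.2.1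
  have hp1 : (p : ℝ) ≤ 1 := p.2.2
  have h0O : (0 : G) ∉ O := fun h => by
    have := (hpar 0 0).1 (by simpa using h)
    tauto
  have hcard : ((Oᶜ.erase 0).card : ℝ) = n - 1 := by
    have h1 : (Oᶜ.erase 0).card = Oᶜ.card - 1 :=
      Finset.card_erase_of_mem (Finset.mem_compl.2 h0O)
    have h2 := Finset.card_add_card_compl O
    rw [Nat.card_eq_fintype_card] at hG
    have h3 : (Oᶜ.erase 0).card + 1 = n := by omega
    rw [← h3]
    push_cast
    ring
  have hmain := setBernoulli_inter_mem_SF_le (S := Oᶜ.erase 0) (s := n / 4) hpar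
    (Finset.disjoint_of_subset_left (Finset.erase_subset _ _) disjoint_compl_left)
    (Finset.notMem_erase _ _) p
  have hbad : bernoulliSum O (p : ℝ)
      (fun B => if ((uncovered (Oᶜ.erase 0) B).card : ℝ) < n / 4 then 1 else 0) ≤
      bernoulliSum O (p : ℝ) (fun B => if (1 + 1) * (p : ℝ) * (O.card : ℝ) < (B.card : ℝ) then 1 else 0) := by
    refine bernoulliSum_mono hp0 hp1 fun B _ => ?_
    by_cases h : (1 + 1) * (p : ℝ) * (O.card : ℝ) < (B.card : ℝ)
    · simp only [h, if_true]
      split_ifs <;> norm_num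
    · have h1 : ¬ ((uncovered (Oᶜ.erase 0) B).card : ℝ) < n / 4 := by
        rw [not_lt] at h ⊢
        have h2 := card_sub_le_card_uncovered (Oᶜ.erase 0) B
        rw [hcard] at h2
        rw [hOn] at h
        have hsq : √(n : ℝ) * √n = n := Real.mul_self_sqrt (by positivity)
        have h3 : (B.card : ℝ) ≤ √n / 2 := by
          have : (p : ℝ) * n = p * √n * √n := by rw [mul_assoc, hsq]
          nlinarith [Real.sqrt_nonneg (n : ℝ)]
        have h4 : (B.card : ℝ) ^ 2 ≤ (√n / 2) ^ 2 := by gcongr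
        nlinarith
      simp [h, h1]
  have hch := bernoulliSum_card_gt_le (U := O) hp0 hp1 zero_le_one le_rfl
  have he1 : Real.exp (-(1 ^ 2 * (p : ℝ) * O.card / 4)) ≤ Real.exp (-(3 * Real.log n)) := by
    rw [Real.exp_le_exp, hOn]
    linarith
  have he2 : Real.exp (-((p : ℝ) * (n / 4))) ≤ Real.exp (-(3 * Real.log n)) := by
    rw [Real.exp_le_exp]
    linarith
  have := five_mul_exp_neg_three_mul_log_le hn
  have := Real.exp_pos (-(3 * Real.log n))
  linarith

set_option maxHeartbeats 1600000 in
/-- The bound for all but very small `p`, in terms of a set `S` of even elements and of the rates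
at which the elements of `S` become covered when the two parts of `O` are exposed in turn. -/
theorem exists_setBernoulli_inter_mem_SF_le {ε κ : ℝ} (hε0 : 0 < ε) (hε1 : ε < 1) (hκ : 0 < κ) :
    ∀ᶠ n : ℕ in atTop, ∀ (G : Type u) [AddCommGroup G] [DecidableEq G] [Fintype G]
      (U₁ U₂ S : Finset G) (p : unitInterval) (c₁ c₂ ρ : ℝ),
      Disjoint U₁ U₂ → (U₁ ∪ U₂).card = n →
      (∀ x y, x + y ∈ U₁ ∪ U₂ ↔ (x ∈ U₁ ∪ U₂ ↔ y ∉ U₁ ∪ U₂)) →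
      Disjoint S (U₁ ∪ U₂) → 0 ∉ S →
      1 / 4 ≤ (p : ℝ) * √n → (p : ℝ) ^ 2 * n ≤ Real.log n →
      0 ≤ c₁ → 0 ≤ c₂ → 0 ≤ ρ →
      (U₁.card = 0 ∨ κ * n ≤ U₁.card) → (U₂.card = 0 ∨ κ * n ≤ U₂.card) →
      (∀ x ∈ S, ∀ A ⊆ U₁,
        (({a ∈ U₁ \ A | Joins x A a} : Finset G).card : ℝ) ≤ c₁ * A.card + 2) →
      (∀ x ∈ S, ∀ C ⊆ U₁, ∀ A ⊆ U₂,
        (({a ∈ U₂ \ A | Joins x (C ∪ A) a} : Finset G).card : ℝ) ≤ c₂ * A.card + 2) →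
      (p : ℝ) ^ 2 * ((c₁ * U₁.card + c₂ * U₂.card) / 2) ≤ (1 - ε) ^ 2 * ρ * Real.log n →
      Real.exp ((1 / 2 + (1 - ε) * ρ + ε / 8) * Real.log n) ≤ S.card →
      (setBernoulli (Set.univ : Set G) p).real {A | A ∩ ((U₁ ∪ U₂ : Finset G) : Set G) ∈ SF A} ≤
        1 / (n : ℝ) ^ 2 := by
  -- `(1 + η) ^ 4 ≤ 1 + 15 η = 1 + ε`, so one factor `1 - ε` absorbs it. The slack `ε / 8 = 4 γ`
  -- pays for `γ` in `s`, for `γ` in each of two rounds and for the additive `2`. Then `t` is chosen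
  -- to make `t γ ≥ 3`.
  set η : ℝ := ε / 15 with hη
  set γ : ℝ := ε / 32 with hγ
  set t : ℕ := ⌈3 / γ⌉₊ with ht
  have hη0 : 0 < η := by positivity
  have hη1 : η ≤ 1 := by linarith
  have hγ0 : 0 < γ := by positivity
  have htγ : 3 ≤ t * γ := by
    have := Nat.le_ceil (3 / γ)
    rwa [div_le_iff₀ hγ0] at this
  have ht1 : 1 ≤ t := Nat.one_le_iff_ne_zero.2 fun h => by
    rw [h] at htγ
    norm_num at htγ
  have hlog : Tendsto (fun n : ℕ => Real.log n) atTop atTop :=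
    Real.tendsto_log_atTop.comp tendsto_natCast_atTop_atTop
  filter_upwards [eventually_ge_atTop 5, hlog.eventually_ge_atTop 1,
    hlog.eventually_ge_atTop (64 / ε), eventually_mul_log_le_exp (16 / η ^ 2) one_pos,
    eventually_mul_log_le_exp 256 one_pos, eventually_mul_log_le_exp (14 * t / η) hγ0,
    eventually_mul_log_le_exp (48 / (η ^ 2 * κ)) one_half_pos,
    eventually_mul_log_le_exp 12 hγ0]
    with n hn hL1 hLε he1 he2 he3 he4 he5
  intro G _ _ _ U₁ U₂ S p c₁ c₂ ρ hdisj hcard hpar hSO hS0 hplow hpup hc₁ hc₂ hρ hN₁ hN₂ hr₁ hr₂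
    hpQ hS
  have hn' : (5 : ℝ) ≤ n := by exact_mod_cast hn
  have hnpos : (0 : ℝ) < n := by linarith
  set L := Real.log n with hL
  have hexpL : Real.exp L = n := Real.exp_log hnpos
  have hsq : √(n : ℝ) = Real.exp (1 / 2 * L) := by
    rw [← hexpL, Real.sqrt_eq_iff_mul_self_eq (Real.exp_pos _).le (Real.exp_pos _).le,
      ← Real.exp_add]
    congr 1
    ring
  have hsqpos : 0 < √(n : ℝ) := Real.sqrt_pos.2 hnpos
  have hsq1 : 1 ≤ √(n : ℝ) := by rw [Real.one_le_sqrt]; linarith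
  have hsqsq : √(n : ℝ) * √n = n := Real.mul_self_sqrt hnpos.le
  have hp0 : 0 ≤ (p : ℝ) := p.2.1
  rw [one_mul, hexpL] at he1 he2
  have hpη : (4 * p : ℝ) ≤ η := by
    refine abs_le_of_sq_le_sq' ?_ hη0.le |>.2
    rw [div_mul_eq_mul_div, div_le_iff₀ (by positivity)] at he1
    have : (n : ℝ) * (4 * p) ^ 2 ≤ n * η ^ 2 := by linarith
    exact le_of_mul_le_mul_left this hnpos
  have hp16 : (p : ℝ) ≤ 1 / 16 := by
    refine abs_le_of_sq_le_sq' ?_ (by norm_num) |>.2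
    have : (n : ℝ) * p ^ 2 ≤ n * (1 / 16) ^ 2 := by linarith
    exact le_of_mul_le_mul_left this hnpos
  -- `s = n ^ (1/2 + γ)`, so `p √n ≥ 1/4` makes `p s` a power of `n`, and one-step drops of order
  -- `√n log n` are negligible against `s`.
  set s : ℝ := Real.exp ((1 / 2 + γ) * L) with hs
  have hs' : s = √n * Real.exp (γ * L) := by
    rw [hsq, hs, ← Real.exp_add]
    congr 1
    ring
  have hcard' : (U₁.card : ℝ) + U₂.card = n := by
    rw [← hcard, Finset.card_union_of_disjoint hdisj]
    push_cast
    ring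
  have hpsqrt : (p : ℝ) * √n ≤ L := by
    have h1 : (p * √n : ℝ) ^ 2 ≤ L ^ 2 := by
      calc (p * √n : ℝ) ^ 2 = p ^ 2 * n := by rw [mul_pow, Real.sq_sqrt hnpos.le]
        _ ≤ L := hpup
        _ ≤ L ^ 2 := by nlinarith
    exact (abs_le_of_sq_le_sq' h1 (by linarith)).2
  have hNi : ∀ N : ℕ, (N = 0 ∨ κ * n ≤ N) → (N = 0 ∨ 12 * L ≤ η ^ 2 * p * N) := by
    intro N hN
    refine hN.imp_right fun h => ?_
    rw [← hsq, div_mul_eq_mul_div, div_le_iff₀ (by positivity)] at he4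
    calc 12 * L ≤ √n * (η ^ 2 * κ) / 4 := by linarith
      _ = η ^ 2 * (1 / 4) * (κ * √n) := by ring
      _ ≤ η ^ 2 * (p * √n) * (κ * √n) := by gcongr
      _ = η ^ 2 * p * (κ * (√n * √n)) := by ring
      _ = η ^ 2 * p * (κ * n) := by rw [hsqsq]
      _ ≤ _ := by gcongr
  have hmain := setBernoulli_inter_mem_SF_le (S := S) (s := s) hpar hSO hS0 p
  have hbad := bernoulliSum_card_uncovered_lt_le (U₁ := U₁) (U₂ := U₂) (S := S) (p := p)
    (η := η) (s := s) (L := L) (γ := γ) (c₁ := c₁) (c₂ := c₂) (t := t) hdisj hS0 hp0 hp16 hη0 hη1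
    (by
      have : (1 + η) ^ 2 ≤ 4 := by nlinarith
      nlinarith)
    (Real.exp_pos _) ht1 htγ (by linarith) hγ0.le hc₁ hc₂
    (by
      rw [hcard', hs']
      rw [div_mul_eq_mul_div, div_le_iff₀ hη0] at he3
      have h1 : 3 * ((1 + η) * p * (n : ℝ)) + 1 ≤ 7 * L * √n := by
        have h2 : (p : ℝ) * n = p * √n * √n := by rw [mul_assoc, hsqsq]
        have h3 : (p : ℝ) * n ≤ L * √n := by rw [h2]; gcongr
        have h4 : (1 + η) * (p * (n : ℝ)) ≤ 2 * (L * √n) := by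
          gcongr
          linarith
        have h5 : 1 ≤ L * √n := one_le_mul_of_one_le_of_one_le hL1 hsq1
        linarith
      calc 2 * t * (3 * ((1 + η) * p * (n : ℝ)) + 1) ≤ 2 * t * (7 * L * √n) := by gcongr
        _ = 14 * t * L * √n := by ring
        _ ≤ Real.exp (γ * L) * η * √n := by gcongr
        _ = _ := by ring)
    (hNi _ hN₁) (hNi _ hN₂) hr₁ hr₂
    (by
      refine le_trans ?_ hS
      rw [hs, ← Real.exp_add, Real.exp_le_exp]
      have h1 : (1 + η) ^ 4 * (1 - ε) ≤ 1 := by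
        have h2 : (1 + η) ^ 4 ≤ 1 + 15 * η := by
          nlinarith [pow_le_one₀ (n := 2) hη0.le hη1, pow_le_one₀ (n := 3) hη0.le hη1]
        have h3 : 15 * η = ε := by rw [hη]; ring
        rw [h3] at h2
        nlinarith
      have h4 : (1 + η) ^ 4 * ((p : ℝ) ^ 2 * ((c₁ * U₁.card + c₂ * U₂.card) / 2)) ≤
          (1 - ε) * ρ * L := by
        calc _ ≤ (1 + η) ^ 4 * ((1 - ε) ^ 2 * ρ * L) := by gcongr
          _ = ((1 + η) ^ 4 * (1 - ε)) * ((1 - ε) * ρ * L) := by ring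
          _ ≤ 1 * ((1 - ε) * ρ * L) := by
            have : 0 ≤ 1 - ε := by linarith
            gcongr
          _ = _ := one_mul _
      rw [div_le_iff₀ hε0] at hLε
      have h5 : γ * L = ε * L / 32 := by rw [hγ]; ring
      linarith)
  have hps : Real.exp (-(p * s)) ≤ Real.exp (-(3 * L)) := by
    rw [Real.exp_le_exp, hs']
    have : 1 / 4 * Real.exp (γ * L) ≤ p * √n * Real.exp (γ * L) := by gcongr
    linarith
  have := five_mul_exp_neg_three_mul_log_le hn
  linarith

end Thresholds

/-! ### The three regimes of the threshold constant. -/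

section GroupCases

universe u

theorem exists_bound_of_card_mul_three {ε : ℝ} (hε0 : 0 < ε) (hε1 : ε < 1) :
    ∀ᶠ n : ℕ in atTop, ∀ (G : Type u) [AddCommGroup G] [DecidableEq G] [Fintype G]
      (O : Finset G) (p : unitInterval), O.card = n → Nat.card G = 2 * n →
      (∀ x y, x + y ∈ O ↔ (x ∈ O ↔ y ∉ O)) → 1 / 4 ≤ (p : ℝ) * √n →
      (p : ℝ) ^ 2 * n ≤ (1 - ε) ^ 2 * (1 / 3) * Real.log n →
      (setBernoulli (Set.univ : Set G) p).real {A | A ∩ (O : Set G) ∈ SF A} ≤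
        1 / (n : ℝ) ^ 2 := by
  have hlog : Tendsto (fun n : ℕ => Real.log n) atTop atTop :=
    Real.tendsto_log_atTop.comp tendsto_natCast_atTop_atTop
  filter_upwards [exists_setBernoulli_inter_mem_SF_le.{u} hε0 hε1 one_pos, eventually_ge_atTop 6,
    hlog.eventually_ge_atTop (8 / (3 * ε)), hlog.eventually_ge_atTop 0]
    with n hcore hn hL hL0 G _ _ _ O p hOn hG hpar hplow hpup
  have hn' : (6 : ℝ) ≤ n := by exact_mod_cast hn
  set S : Finset G := {x | x ∉ O ∧ x ≠ 0 ∧ ({a ∈ O | a + a = x} : Finset G).card ≤ 2} with hS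
  have hSmem : ∀ x ∈ S, x ∉ O ∧ x ≠ 0 ∧ ({a ∈ O | a + a = x} : Finset G).card ≤ 2 :=
    fun x hx => (Finset.mem_filter.1 hx).2
  have hε2 : (1 - ε) ^ 2 ≤ 1 := by nlinarith
  -- A single round with rate `3`; the exponent is `ρ = (3 / 2) (1 / 3) = 1 / 2`.
  have key := hcore G ∅ O S p 0 3 (1 / 2) (Finset.disjoint_empty_left _)
    (by rw [Finset.empty_union, hOn]) (by rwa [Finset.empty_union])
    (by
      rw [Finset.empty_union]
      exact Finset.disjoint_left.2 fun x hx => (hSmem x hx).1)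
    (fun h => (hSmem 0 h).2.1 rfl) hplow (by nlinarith) le_rfl (by norm_num) (by norm_num)
    (Or.inl rfl) (Or.inr (by rw [hOn, one_mul]))
    (fun x _ A hA => by simp)
    (fun x hx C hC A hA => by
      rw [Finset.subset_empty.1 hC, Finset.empty_union]
      exact_mod_cast card_filter_joins_le_three (hSmem x hx).2.2)
    (by
      rw [hOn, zero_mul, zero_add]
      nlinarith)
    (by
      have h1 := two_mul_card_le_card_few_halves (O := O) (by rw [hOn, hG])
      rw [← hS, hOn] at h1
      have h2 : 2 * (n : ℝ) ≤ 3 * S.card + 3 := by exact_mod_cast h1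
      have h3 : (n : ℝ) / 2 ≤ S.card := by linarith
      refine le_trans ?_ h3
      rw [le_div_iff₀ two_pos]
      have h4 : 2 ≤ Real.exp (3 * ε / 8 * Real.log n) := by
        have := Real.add_one_le_exp (3 * ε / 8 * Real.log n)
        rw [div_le_iff₀ (by positivity)] at hL
        linarith
      calc _ ≤ Real.exp ((1 / 2 + (1 - ε) * (1 / 2) + ε / 8) * Real.log n) *
            Real.exp (3 * ε / 8 * Real.log n) := by gcongr
        _ = Real.exp (Real.log n) := by
          rw [← Real.exp_add]
          congr 1
          ring
        _ = n := Real.exp_log (by linarith))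
  rwa [Finset.empty_union] at key

/-- There are `2 n / r` doubles, which is at most `r / 8` once `r² ≥ 16 n`, and at least half of the
involutions are even. -/
theorem card_even_not_double_ge {G : Type u} [AddCommGroup G] [DecidableEq G] [Fintype G] {n : ℕ}
    {O : Finset G} (hG : Nat.card G = 2 * n) (hpar : ∀ x y, x + y ∈ O ↔ (x ∈ O ↔ y ∉ O))
    (hr : 16 * (n : ℝ) ≤ (({x | x = -x} : Finset G).card : ℝ) ^ 2) :
    (({x | x = -x} : Finset G).card : ℝ) / 4 ≤
      ({x | x ∉ O ∧ x = -x ∧ ∀ a, a + a ≠ x} : Finset G).card := by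
  have h1 := card_involutions_le_card_even_not_double hpar
  have h2 := card_range_double_mul (G := G)
  rw [hG] at h2
  set r := ({x | x = -x} : Finset G).card
  set k := (Finset.univ.image (fun a : G => a + a)).card
  set m := ({x | x ∉ O ∧ x = -x ∧ ∀ a, a + a ≠ x} : Finset G).card
  have hr0 : 0 < r := Finset.card_pos.2 ⟨0, by simp⟩
  have hr0' : (0 : ℝ) < r := by exact_mod_cast hr0
  have h1' : (r : ℝ) ≤ 2 * m + 2 * k := by exact_mod_cast h1
  have h2' : (k : ℝ) * r = 2 * n := by exact_mod_cast h2
  have h3 : (k : ℝ) ≤ r / 8 := by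
    refine le_of_mul_le_mul_right ?_ hr0'
    nlinarith
  linarith

theorem exists_bound_of_card_mul_two {ε : ℝ} (hε0 : 0 < ε) (hε1 : ε < 1) :
    ∀ᶠ n : ℕ in atTop, ∀ (G : Type u) [AddCommGroup G] [DecidableEq G] [Fintype G]
      (O : Finset G) (p : unitInterval) (ρ : ℝ), O.card = n → Nat.card G = 2 * n →
      (∀ x y, x + y ∈ O ↔ (x ∈ O ↔ y ∉ O)) → 1 / 4 ≤ (p : ℝ) * √n → 0 ≤ ρ → ρ ≤ 1 →
      (p : ℝ) ^ 2 * n ≤ (1 - ε) ^ 2 * ρ * Real.log n →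
      16 * (n : ℝ) ≤ (({x | x = -x} : Finset G).card : ℝ) ^ 2 →
      Real.exp ((1 / 2 + (1 - ε) * ρ + ε / 8) * Real.log n) * 4 ≤
        ({x | x = -x} : Finset G).card →
      (setBernoulli (Set.univ : Set G) p).real {A | A ∩ (O : Set G) ∈ SF A} ≤
        1 / (n : ℝ) ^ 2 := by
  have hlog : Tendsto (fun n : ℕ => Real.log n) atTop atTop :=
    Real.tendsto_log_atTop.comp tendsto_natCast_atTop_atTop
  filter_upwards [exists_setBernoulli_inter_mem_SF_le.{u} hε0 hε1 one_pos,
    hlog.eventually_ge_atTop 0]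
    with n hcore hL0 G _ _ _ O p ρ hOn hG hpar hplow hρ0 hρ1 hpup hr hstart
  set S : Finset G := {x | x ∉ O ∧ x = -x ∧ ∀ a, a + a ≠ x} with hS
  have hSmem : ∀ x ∈ S, x ∉ O ∧ x = -x ∧ ∀ a, a + a ≠ x :=
    fun x hx => (Finset.mem_filter.1 hx).2
  have hε2 : (1 - ε) ^ 2 * ρ ≤ 1 := mul_le_one₀ (by nlinarith) hρ0 hρ1
  have key := hcore G ∅ O S p 0 2 ρ (Finset.disjoint_empty_left _)
    (by rw [Finset.empty_union, hOn]) (by rwa [Finset.empty_union])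
    (by
      rw [Finset.empty_union]
      exact Finset.disjoint_left.2 fun x hx => (hSmem x hx).1)
    (fun h => (hSmem 0 h).2.2 0 (add_zero 0)) hplow (by nlinarith) le_rfl (by norm_num) hρ0
    (Or.inl rfl) (Or.inr (by rw [hOn, one_mul]))
    (fun x _ A hA => by simp)
    (fun x hx C hC A hA => by
      have h1 := card_filter_joins_le_two (U := O) (A := A) (C := C) (hSmem x hx).2.1
        (hSmem x hx).2.2 (by simp [Finset.subset_empty.1 hC]) (by simp [Finset.subset_empty.1 hC])
      have h2 : (({a ∈ O \ A | Joins x (C ∪ A) a} : Finset G).card : ℝ) ≤ 2 * A.card := by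
        exact_mod_cast h1
      linarith)
    (by
      rw [hOn, zero_mul, zero_add]
      linarith)
    (by
      have h1 := card_even_not_double_ge hG hpar hr
      rw [← hS] at h1
      linarith)
  rwa [Finset.empty_union] at key

theorem exists_bound_of_card_odd_eq_card_even {ε δ : ℝ} (hε0 : 0 < ε) (hε1 : ε < 1)
    (hδ0 : 0 < δ) :
    ∀ᶠ n : ℕ in atTop, ∀ (G : Type u) [AddCommGroup G] [DecidableEq G] [Fintype G]
      (O : Finset G) (p : unitInterval), O.card = n → Nat.card G = 2 * n →
      (∀ x y, x + y ∈ O ↔ (x ∈ O ↔ y ∉ O)) → 1 / 4 ≤ (p : ℝ) * √n →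
      (p : ℝ) ^ 2 * n ≤ Real.log n →
      2 * ({x ∈ O | x = -x} : Finset G).card = ({x | x = -x} : Finset G).card →
      δ * n ≤ ({x | x = -x} : Finset G).card →
      (p : ℝ) ^ 2 * (n - ({x | x = -x} : Finset G).card / 4) ≤
        (1 - ε) ^ 2 * (1 / 2) * Real.log n →
      16 * (n : ℝ) ≤ (({x | x = -x} : Finset G).card : ℝ) ^ 2 →
      Real.exp ((1 / 2 + (1 - ε) * (1 / 2) + ε / 8) * Real.log n) * 4 ≤
        ({x | x = -x} : Finset G).card →
      (setBernoulli (Set.univ : Set G) p).real {A | A ∩ (O : Set G) ∈ SF A} ≤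
        1 / (n : ℝ) ^ 2 := by
  filter_upwards [exists_setBernoulli_inter_mem_SF_le.{u} hε0 hε1 (half_pos hδ0)]
    with n hcore G _ _ _ O p hOn hG hpar hplow hpup hodd hδr hpQ hr hstart
  set S : Finset G := {x | x ∉ O ∧ x = -x ∧ ∀ a, a + a ≠ x} with hS
  have hSmem : ∀ x ∈ S, x ∉ O ∧ x = -x ∧ ∀ a, a + a ≠ x :=
    fun x hx => (Finset.mem_filter.1 hx).2
  set U₁ : Finset G := {x ∈ O | x = -x} with hU₁
  set U₂ : Finset G := {x ∈ O | ¬ x = -x} with hU₂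
  have hU : U₁ ∪ U₂ = O := Finset.filter_union_filter_not_eq _ _
  have hdisj : Disjoint U₁ U₂ := Finset.disjoint_filter_filter_not _ _ _
  have hcard : U₁.card + U₂.card = n := by rw [← Finset.card_union_of_disjoint hdisj, hU, hOn]
  have hcard' : (U₁.card : ℝ) + U₂.card = n := by exact_mod_cast hcard
  have hodd' : 2 * (U₁.card : ℝ) = ({x | x = -x} : Finset G).card := by exact_mod_cast hodd
  have hU₁mem : ∀ x ∈ U₁, x = -x := fun x hx => (Finset.mem_filter.1 hx).2
  -- Either every element is an involution and `U₂` is empty, or there are at most `n` involutions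
  -- and at most `n / 2` of them are odd.
  have hN₂ : U₂.card = 0 ∨ δ / 2 * n ≤ U₂.card := by
    rcases card_involutions_eq_or_le hG with h | h
    · left
      rw [Finset.card_eq_zero, hU₂, Finset.filter_eq_empty_iff]
      intro x _ hx
      exact hx (h x)
    · right
      have : (({x | x = -x} : Finset G).card : ℝ) ≤ n := by exact_mod_cast h
      nlinarith
  have key := hcore G U₁ U₂ S p 1 2 (1 / 2) hdisj (by rw [hU, hOn]) (by rwa [hU])
    (by
      rw [hU]
      exact Finset.disjoint_left.2 fun x hx => (hSmem x hx).1)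
    (fun h => (hSmem 0 h).2.2 0 (add_zero 0)) hplow hpup zero_le_one zero_le_two (by norm_num)
    (Or.inr (by linarith)) hN₂
    (fun x hx A hA => by
      have h1 := card_filter_joins_le_one (hSmem x hx).2.1 (hSmem x hx).2.2 hU₁mem hA
      have h2 : (({a ∈ U₁ \ A | Joins x A a} : Finset G).card : ℝ) ≤ A.card := by
        exact_mod_cast h1
      linarith)
    (fun x hx C hC A hA => by
      have h1 := card_filter_joins_le_two (U := U₂) (A := A) (C := C) (hSmem x hx).2.1
        (hSmem x hx).2.2 (fun y hy => hU₁mem y (hC hy)) (fun y hy a ha hya => by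
          refine (Finset.mem_filter.1 ha).2 ?_
          rw [← hya, neg_add, ← (hSmem x hx).2.1, ← hU₁mem y (hC hy)])
      have h2 : (({a ∈ U₂ \ A | Joins x (C ∪ A) a} : Finset G).card : ℝ) ≤ 2 * A.card := by
        exact_mod_cast h1
      linarith)
    (by
      have : (1 * (U₁.card : ℝ) + 2 * U₂.card) / 2 = n - ({x | x = -x} : Finset G).card / 4 := by
        linarith
      rw [this]
      exact hpQ)
    (by
      have h1 := card_even_not_double_ge hG hpar hr
      rw [← hS] at h1
      linarith)
  rwa [hU] at key

end GroupCases

/-! ### Assembly of the proposition. -/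

set_option maxHeartbeats 1000000 in
theorem mainTheorem2 : ∀ ε : ℝ, 0 < ε → ∃ δ₀ : ℝ, 0 < δ₀ ∧ ∀ δ : ℝ, 0 < δ → δ < δ₀ →
    ∀ ω : ℕ → ℝ, Tendsto ω atTop atTop → ∃ n₀ : ℕ, ∀ n : ℕ, n₀ ≤ n →
    ∀ (G : Type*) [AddCommGroup G] [Finite G], Nat.card G = 2 * n →
    ∀ O ∈ SF (Set.univ : Set G), IsNice δ Oᶜ →
    ∀ p : unitInterval, 0 < (p : ℝ) → (p : ℝ) < 1 →
      ω n * (Real.log n / n) ≤ p →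
      (p : ℝ) ≤ (1 - ε) * Real.sqrt (thresholdConst G δ * (Real.log n / n)) →
      (setBernoulli (Set.univ : Set G) p).real {A | A ∩ O ∈ SF A} ≤ 1 / (n : ℝ) ^ 2 := by
  intro ε hε0
  -- For `ε ≥ 1` the upper bound on `p` is nonpositive, contradicting `0 < p`.
  rcases le_or_gt 1 ε with hε1 | hε1
  · refine ⟨1, one_pos, fun δ _ _ ω _ => ⟨0, fun n _ G _ _ _ O _ _ p hp0 _ _ hp => ?_⟩⟩
    have := mul_nonneg (sub_nonneg.2 hε1)
      (Real.sqrt_nonneg (thresholdConst G δ * (Real.log n / n)))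
    linarith
  refine ⟨ε, hε0, fun δ hδ0 hδε ω hω => ?_⟩
  have hlog : Tendsto (fun n : ℕ => Real.log n) atTop atTop :=
    Real.tendsto_log_atTop.comp tendsto_natCast_atTop_atTop
  refine eventually_atTop.1 ?_
  filter_upwards [exists_bound_of_card_mul_three hε0 hε1, exists_bound_of_card_mul_two hε0 hε1,
    exists_bound_of_card_odd_eq_card_even hε0 hε1 hδ0,
    hω.eventually_ge_atTop 12, eventually_ge_atTop 5, hlog.eventually_ge_atTop (64 / (ε * δ))]
    with n hA hB hC hωn hn hLlow G _ _ hG O hO hnice p hp0 hp1 hplow hpup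
  have hn' : (5 : ℝ) ≤ n := by exact_mod_cast hn
  have hnpos : (0 : ℝ) < n := by linarith
  have hsqsq : √(n : ℝ) * √n = n := Real.mul_self_sqrt hnpos.le
  set L := Real.log n with hL
  have hexpL : Real.exp L = n := Real.exp_log hnpos
  rw [div_le_iff₀ (by positivity)] at hLlow
  have hL0 : 0 < L := Real.log_pos (by linarith)
  have hLε : 64 ≤ L * ε := by nlinarith [mul_pos hL0 hε0]
  have hL64 : 64 ≤ L := by nlinarith
  have hLδ : 8 * (4 / δ) ≤ L * ε := by
    rw [mul_div_assoc', div_le_iff₀ hδ0]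
    linarith
  obtain ⟨hOn2, hpar⟩ := two_mul_ncard_and_add_mem_iff_of_mem_SF (by rw [hG]; exact ⟨n, rfl⟩) hO
  classical
  let _ : Fintype G := Fintype.ofFinite G
  obtain ⟨O, rfl⟩ : ∃ F : Finset G, (F : Set G) = O := ⟨O.toFinset, by simp⟩
  rw [Set.ncard_coe_finset] at hOn2
  have hOn : O.card = n := by omega
  simp only [Finset.mem_coe] at hpar
  have hpn : 12 * L ≤ p * n := by
    have h1 : 12 * (L / n) ≤ p := le_trans (by gcongr) hplow
    calc 12 * L = 12 * (L / n) * n := by field_simp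
      _ ≤ p * n := by gcongr
  rcases le_total ((p : ℝ) * √n) (1 / 4) with hsmall | hlarge
  · exact setBernoulli_inter_mem_SF_le_of_small hn hOn hG hpar p hsmall hpn
  have hhalf : halfOrder G = n := by
    rw [halfOrder, hG]
    push_cast
    ring
  set R : ℕ := ({x | x = -x} : Finset G).card with hR
  have hrR : r (Set.univ : Set G) = R := by
    rw [r, hR, ← Set.ncard_coe_finset]
    congr 1
    ext x
    simp
  have hRpos : (0 : ℝ) < R := by
    have : 0 < R := Finset.card_pos.2 ⟨0, by simp⟩
    exact_mod_cast this
  have hR2n : (R : ℝ) ≤ 2 * n := by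
    have : R ≤ 2 * n := by
      rw [← hG, Nat.card_eq_fintype_card]
      exact Finset.card_le_univ _
    exact_mod_cast this
  have hpsq : 0 ≤ thresholdConst G δ →
      (p : ℝ) ^ 2 * n ≤ (1 - ε) ^ 2 * thresholdConst G δ * L := by
    intro hlam
    have h1 : (p : ℝ) ^ 2 ≤ ((1 - ε) * √(thresholdConst G δ * (L / n))) ^ 2 := by gcongr
    rw [mul_pow, Real.sq_sqrt (by positivity)] at h1
    calc (p : ℝ) ^ 2 * n ≤ (1 - ε) ^ 2 * (thresholdConst G δ * (L / n)) * n := by gcongr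
      _ = _ := by field_simp
  -- When a fixed proportion `a` of `n` bounds the involutions from below, a spare power `n ^ c`
  -- absorbs the constant `4 / a`.
  have hfrac : ∀ {c M : ℝ}, M ≤ (1 - c) * L → ∀ {a : ℝ}, 0 < a → 4 / a ≤ Real.exp (c * L) →
      Real.exp M * 4 ≤ a * n := by
    intro c M hM a ha hc
    rw [div_le_iff₀ ha] at hc
    calc Real.exp M * 4 ≤ Real.exp ((1 - c) * L) * (Real.exp (c * L) * a) := by gcongr
      _ = a * (Real.exp ((1 - c) * L) * Real.exp (c * L)) := by ring
      _ = a * n := by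
        rw [← Real.exp_add, ← hexpL]
        congr 2
        ring
  have hδexp : 4 / δ ≤ Real.exp (ε / 8 * L) := by
    have := Real.add_one_le_exp (ε / 8 * L)
    linarith
  by_cases hα : alpha G ≤ 5 / 6
  · have hlam : thresholdConst G δ = 1 / 3 := by rw [thresholdConst, if_pos hα]
    rw [hlam] at hpsq
    exact hA G O p hOn hG hpar hlarge (hpsq (by norm_num))
  have hα' : 5 / 6 < alpha G := not_le.1 hα
  have hRα : (R : ℝ) = Real.exp (alpha G * L) := by
    rw [alpha, hrR, hhalf, div_mul_cancel₀ _ hL0.ne', Real.exp_log hRpos]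
  have hRsq : 16 * (n : ℝ) ≤ (R : ℝ) ^ 2 := by
    rw [hRα, ← Real.exp_nat_mul]
    have h1 : 16 ≤ Real.exp (2 / 3 * L) := by
      have := Real.add_one_le_exp (2 / 3 * L)
      linarith
    calc 16 * (n : ℝ) ≤ Real.exp (2 / 3 * L) * Real.exp L := by rw [hexpL]; gcongr
      _ ≤ _ := by
        rw [← Real.exp_add, Real.exp_le_exp]
        push_cast
        nlinarith
  by_cases hβ : beta G < δ
  · have hlam : thresholdConst G δ = alpha G - 1 / 2 := by
      rw [thresholdConst, if_neg hα, if_pos hβ]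
    rw [SumFreeThreshold.beta, hrR, hhalf, div_lt_iff₀ hnpos] at hβ
    have hα1 : alpha G ≤ 1 := by
      have h1 : Real.exp (alpha G * L) ≤ Real.exp L := by
        rw [← hRα, hexpL]
        nlinarith
      rw [Real.exp_le_exp] at h1
      by_contra h
      nlinarith
    rw [hlam] at hpsq
    refine hB G O p (alpha G - 1 / 2) hOn hG hpar hlarge (by linarith) (by linarith)
      (hpsq (by linarith)) hRsq ?_
    rw [← hR, hRα]
    -- Since `α - 1/2 > 1/3`, the spare exponent `ε (α - 1/2) - ε / 8` exceeds `ε / 3 - ε / 8 = 5 ε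
    -- / 24`.
    have h1 : 4 ≤ Real.exp (5 * ε / 24 * L) := by
      have := Real.add_one_le_exp (5 * ε / 24 * L)
      linarith
    calc _ ≤ Real.exp ((1 / 2 + (1 - ε) * (alpha G - 1 / 2) + ε / 8) * L) *
          Real.exp (5 * ε / 24 * L) := by gcongr
      _ ≤ _ := by
        rw [← Real.exp_add, Real.exp_le_exp, ← add_mul]
        gcongr
        nlinarith
  have hlam : thresholdConst G δ = 2 / (4 - beta G) := by
    rw [thresholdConst, if_neg hα, if_neg hβ]
  have hβR : beta G * n = R := by
    rw [SumFreeThreshold.beta, hrR, hhalf]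
    field_simp
  have hβδ : δ ≤ beta G := not_lt.1 hβ
  have hδR : δ * n ≤ R := by
    rw [← hβR]
    gcongr
  have hβ2 : beta G ≤ 2 := by
    rw [← hβR] at hR2n
    exact le_of_mul_le_mul_right hR2n hnpos
  have h4β : 0 < 4 - beta G := by linarith
  have hlam1 : 2 / (4 - beta G) ≤ 1 := by
    rw [div_le_one h4β]
    linarith
  have hlam0 : 0 ≤ 2 / (4 - beta G) := by positivity
  rw [hlam] at hpsq
  specialize hpsq hlam0
  rcases hnice with hnice | hnice
  -- Here `β = δ`. As `δ < ε`, the constant `2 / (4 - β)` is so close to `1/2` that the single-round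
  -- bound with rate `2` suffices; this is what `δ₀ = ε` is for.
  · rw [hrR, hhalf, ← hβR] at hnice
    have hβδ' : beta G ≤ δ := le_of_mul_le_mul_right hnice hnpos
    refine hB G O p (2 / (4 - beta G)) hOn hG hpar hlarge hlam0 hlam1 hpsq hRsq ?_
    refine le_trans (hfrac ?_ hδ0 hδexp) hδR
    gcongr
    have h1 : (1 - ε) * (2 / (4 - beta G)) ≤ 1 / 2 - ε / 4 := by
      rw [mul_div_assoc', div_le_iff₀ h4β]
      nlinarith
    linarith
  · have hodd : 2 * ({x ∈ O | x = -x} : Finset G).card = R := by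
      have h1 : ∀ F : Finset G, r (F : Set G) = ({x ∈ F | x = -x} : Finset G).card := by
        intro F
        rw [r, ← Set.ncard_coe_finset]
        congr 1
        ext x
        simp
      rw [compl_compl, ← Finset.coe_compl, h1, h1] at hnice
      have h2 : R = ({x ∈ O | x = -x} : Finset G).card + ({x ∈ Oᶜ | x = -x} : Finset G).card := by
        rw [hR, ← Finset.card_union_of_disjoint
          (Finset.disjoint_filter_filter disjoint_compl_right), ← Finset.filter_union,
          Finset.union_compl]
      omega
    refine hC G O p hOn hG hpar hlarge ?_ hodd hδR ?_ hRsq ?_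
    · have : (1 - ε) ^ 2 * (2 / (4 - beta G)) ≤ 1 := mul_le_one₀ (by nlinarith) hlam0 hlam1
      nlinarith
    · rw [← hR, ← hβR]
      have h1 : (p : ℝ) ^ 2 * (n - beta G * n / 4) =
          (p : ℝ) ^ 2 * n * ((4 - beta G) / 4) := by ring
      rw [h1]
      calc _ ≤ (1 - ε) ^ 2 * (2 / (4 - beta G)) * L * ((4 - beta G) / 4) := by gcongr
        _ = _ := by
          field_simp
          ring
    · refine le_trans (hfrac ?_ hδ0 hδexp) hδR
      gcongr
      linarith
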